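/- Let $F$ be a field of characteristic $\neq 2$ and let $A$ be a (not necessarily associative, commutative, unital or finite-dimensional) $F$-algebra. For $a\in A$ let $A_\mu(L_a)$, $A_\mu(R_a)$ be the $\mu$-eigenspaces of $L_a:z\mapsto az$ and $R_a:z\mapsto za$. For $\lambda,\delta\in F\setminus\{0,1\}$, a *primitive axis of type $(\lambda,\delta)$* is a nonzero idempotent $a$ with $L_aR_a=R_aL_a$ and $A_1(L_a)=Fa=A_1(R_a)$ such that $A=\big(A_1(L_a)\oplus A_0(L_a)\big)\oplus A_\lambda(L_a)$ and $A=\big(A_1(R_a)\oplus A_0(R_a)\big)\oplus A_\delta(R_a)$ are $\mathbb Z_2$-gradings of $A$ (first summand even, second odd), and $A_\lambda(L_a)\cap A_0(R_a)=0=A_0(L_a)\cap A_\delta(R_a)$. Then $A=Fa\oplus A_0(a)\oplus A_{\lambda,\delta}(a)$, where $A_0(a)=A_0(L_a)\cap A_0(R_a)$ and $A_{\lambda,\delta}(a)=A_\lambda(L_a)\cap A_\delta(R_a)$, and $\varphi_a(u)\in F$ denotes the coefficient of $a$ in the corresponding decomposition of $u\in A$. When $\lambda=\delta$ we say that $a$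 is of (commutative) type $\lambda$. Let $\chi(A)$ be the set of all primitive axes of $A$ (of any type). $A$ is a *primitive axial algebra of Jordan type (PAJ)* if it is generated as an algebra by a subset of $\chi(A)$. The *axial graph* has vertex set $\chi(A)$, distinct $x,y$ being joined when $xy\ne0$ or $yx\neq 0$ (for a PAJ these two conditions are equivalent). For a connected component $Y$ let $Y_\lambda$ be the set of its axes of commutative type $\lambda$. Call $Y$ *mixed* of types $\lambda,1-\lambda$ if $\lambda\ne\frac12$, $Y=Y_\lambda\cup Y_{1-\lambda}$, and both parts are nonempty. Call $X'\subseteq\chi(A)$ *selected* if for every component $Y$: if $Y$ is not mixed, then $X'\cap Y=Y$; if $Y$ is mixed of types $\lambda,1-\lambda$ with $\lambda\in\{-1,2\}$, then $X'\cap Y=Y_2$; and if $Y$ is mixed of types $\lambda,1-\lambda$ with $\lambda\notin\{-1,2\}$, then $X'\cap Y$ is one of $Y_\lambda$, $Y_{1-\lambda}$ (this is the choice of "$\lambda_i$" for the component $Y$). A *Frobenius form* on $A$ is a nonzero bilinear form with $(x,yz)=(xy,z)$ for all $x,y,z\in A$; it is *normalized* with respect to $X'$ if $(a,a)=1$ for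 all $a\in X'$. The *radical* of a Frobenius form is $\{u\in A:(u,v)=0\text{ for all }v\in A\}$. **Theorem.** Let $A\neq 0$ be a PAJ. 1. Selected sets exist. For every selected set $X'$: $X'$ spans $A$; there is exactly one Frobenius form on $A$ normalized with respect to $X'$ (so the normalized form is unique up to the choice of the $\lambda_i$); and this form satisfies $(a,u)=\varphi_a(u)$ for all $a\in X'$ and $u\in A$. 2. For every primitive axis $a\in A$, either there is a selected set $X'$ with $a\in X'$, or else $-1\ne\frac12$ in $F$, $a$ is of type $-1$, there is a primitive axis $b$ of type $2$ with $ab\ne0$, and $a$ lies in the radical of every Frobenius form on $A$. -/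

import Mathlib

/-! Primitive axial algebras of Jordan type over a field `F`.  An algebra over `F` is a not
necessarily associative, commutative or unital ring `A` with a compatible `F`-module structure. -/

section AxialAlgebras

variable (F : Type*) [Field F] {A : Type*} [NonUnitalNonAssocRing A] [Module F A]
  [IsScalarTower F A A] [SMulCommClass F A A]

/-- The `μ`-eigenspace of `L_a : z ↦ a * z`. -/
def leftEigenspace (a : A) (μ : F) : Submodule F A :=
  Module.End.eigenspace (LinearMap.mulLeft F a) μ

/-- The `μ`-eigenspace of `R_a : z ↦ z * a`. -/
def rightEigenspace (a : A) (μ : F) : Submodule F A :=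
  Module.End.eigenspace (LinearMap.mulRight F a) μ

variable {F}

/-- `A = V₀ ⊕ V₁` is a `ℤ/2`-grading of the algebra `A`, with even part `V₀` and odd part `V₁`. -/
structure IsZ2Grading (V₀ V₁ : Submodule F A) : Prop where
  isCompl : IsCompl V₀ V₁
  even_mul_even : ∀ x ∈ V₀, ∀ y ∈ V₀, x * y ∈ V₀
  even_mul_odd : ∀ x ∈ V₀, ∀ y ∈ V₁, x * y ∈ V₁
  odd_mul_even : ∀ x ∈ V₁, ∀ y ∈ V₀, x * y ∈ V₁
  odd_mul_odd : ∀ x ∈ V₁, ∀ y ∈ V₁, x * y ∈ V₀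

/-- `a` is a primitive axis of type `(lam, del)`: a nonzero idempotent that is a primitive left
axis of type `lam` and a primitive right axis of type `del`, with `L_a R_a = R_a L_a`, and such
that the mixed eigenspaces `A_{lam,0}(a)` and `A_{0,del}(a)` vanish.

The eigenspaces for the distinct eigenvalues `1, 0, lam` are automatically independent, so
`left_grading` contains the decomposition `A = A_1(L_a) ⊕ A_0(L_a) ⊕ A_lam(L_a)`; likewise on the
right.  The eigenvalues `lam` and `del` are allowed not to occur. -/
structure IsPrimitiveAxisOfType (a : A) (lam del : F) : Prop where
  ne_zero : a ≠ 0
  idem : a * a = a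
  lam_ne_zero : lam ≠ 0
  lam_ne_one : lam ≠ 1
  del_ne_zero : del ≠ 0
  del_ne_one : del ≠ 1
  left_primitive : leftEigenspace F a 1 = Submodule.span F {a}
  right_primitive : rightEigenspace F a 1 = Submodule.span F {a}
  left_grading : IsZ2Grading (leftEigenspace F a 1 ⊔ leftEigenspace F a 0) (leftEigenspace F a lam)
  right_grading :
    IsZ2Grading (rightEigenspace F a 1 ⊔ rightEigenspace F a 0) (rightEigenspace F a del)
  comm : ∀ y : A, a * (y * a) = (a * y) * a
  lam_zero : leftEigenspace F a lam ⊓ rightEigenspace F a 0 = ⊥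
  zero_del : leftEigenspace F a 0 ⊓ rightEigenspace F a del = ⊥

variable (F)

/-- `a` is a primitive axis, of some type. -/
def IsPrimitiveAxis (a : A) : Prop :=
  ∃ lam del : F, IsPrimitiveAxisOfType a lam del

variable (A)

/-- The set `χ(A)` of all primitive axes of `A`, as a type. -/
abbrev PrimitiveAxis : Type _ := {a : A // IsPrimitiveAxis F a}

/-- `A` is a primitive axial algebra of Jordan type: it is generated, as an `F`-algebra, by a set
of primitive axes, which need not be of the same type. -/
def IsPAJ : Prop :=
  ∃ X : Set A, (∀ a ∈ X, IsPrimitiveAxis F a) ∧ NonUnitalAlgebra.adjoin F X = ⊤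

/-- The axial graph on `χ(A)`: distinct axes are joined when their product is nonzero. -/
def axialGraph : SimpleGraph (PrimitiveAxis F A) :=
  SimpleGraph.fromRel fun x y => (x : A) * (y : A) ≠ 0

variable {A}

open Classical in
/-- `φ_a(y)`: the scalar `c` such that `c • a` is the projection of `y` to the `1`-eigenspace
`F a` of the primitive axis `a`, along the sum of the other eigenspaces.
(The value is `0` if there is no such scalar.) -/
noncomputable def axisProj (a y : A) : F :=
  if h : ∃ c : F, y - c • a ∈ ⨆ μ : {μ : F // μ ≠ 1}, leftEigenspace F a (μ : F)
  then h.choose else 0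

/-- `axisProj` is the coefficient of `a` in the decomposition
`y = c a + y₀ + y₁` with `y₀ ∈ A_0(a)` and `y₁ ∈ A_{lam,del}(a)`. -/
theorem axisProj_eq {a : A} {lam del : F} (ha : IsPrimitiveAxisOfType a lam del) (c : F)
    {y₀ y₁ : A} (h₀ : y₀ ∈ leftEigenspace F a 0 ⊓ rightEigenspace F a 0)
    (h₁ : y₁ ∈ leftEigenspace F a lam ⊓ rightEigenspace F a del) :
    axisProj F a (c • a + y₀ + y₁) = c := by
  have hex : ∃ d : F, (c • a + y₀ + y₁) - d • a ∈
      ⨆ μ : {μ : F // μ ≠ 1}, leftEigenspace F a (μ : F) := by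
    refine ⟨c, ?_⟩
    have e : c • a + y₀ + y₁ - c • a = y₀ + y₁ := by abel
    rw [e]
    exact Submodule.add_mem _
      (Submodule.mem_iSup_of_mem (p := fun μ : {μ : F // μ ≠ 1} => leftEigenspace F a (μ : F))
        ⟨0, zero_ne_one⟩ h₀.1)
      (Submodule.mem_iSup_of_mem (p := fun μ : {μ : F // μ ≠ 1} => leftEigenspace F a (μ : F))
        ⟨lam, ha.lam_ne_one⟩ h₁.1)
  have hspec := hex.choose_spec
  rw [axisProj, dif_pos hex]
  generalize hex.choose = d at hspec ⊢
  have hc : y₀ + y₁ ∈ ⨆ μ : {μ : F // μ ≠ 1}, leftEigenspace F a (μ : F) :=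
    Submodule.add_mem _
      (Submodule.mem_iSup_of_mem (p := fun μ : {μ : F // μ ≠ 1} => leftEigenspace F a (μ : F))
        ⟨0, zero_ne_one⟩ h₀.1)
      (Submodule.mem_iSup_of_mem (p := fun μ : {μ : F // μ ≠ 1} => leftEigenspace F a (μ : F))
        ⟨lam, ha.lam_ne_one⟩ h₁.1)
  have hd : (c - d) • a ∈ ⨆ μ : {μ : F // μ ≠ 1}, leftEigenspace F a (μ : F) := by
    have e : (c - d) • a = (c • a + y₀ + y₁ - d • a) - (y₀ + y₁) := by
      rw [sub_smul]; abel
    rw [e]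
    exact Submodule.sub_mem _ hspec hc
  have ha1 : (c - d) • a ∈ leftEigenspace F a 1 := by
    rw [ha.left_primitive]
    exact Submodule.smul_mem _ _ (Submodule.mem_span_singleton_self a)
  have hdis := (Module.End.eigenspaces_iSupIndep (LinearMap.mulLeft F a)) 1
  rw [iSup_subtype] at hd
  have hz := Submodule.disjoint_def.1 hdis _ ha1 hd
  rcases smul_eq_zero.1 hz with h | h
  · exact (sub_eq_zero.1 h).symm
  · exact absurd h ha.ne_zero

variable {F}

/-- `Y_lam`: the axes of commutative type `lam` in a connected component `Y` of `χ(A)`. -/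
def componentOfType (Y : (axialGraph F A).ConnectedComponent) (lam : F) :
    Set (PrimitiveAxis F A) :=
  {x | x ∈ Y.supp ∧ IsPrimitiveAxisOfType (x : A) lam lam}

/-- The component `Y` is mixed, of types `lam` and `1 - lam`, where `lam ≠ 1/2`:
`Y = Y_lam ∪ Y_{1 - lam}` with both parts nonempty. -/
structure IsMixed (Y : (axialGraph F A).ConnectedComponent) (lam : F) : Prop where
  ne_half : lam ≠ 1 / 2
  union_eq : Y.supp = componentOfType Y lam ∪ componentOfType Y (1 - lam)
  nonempty_left : (componentOfType Y lam).Nonempty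
  nonempty_right : (componentOfType Y (1 - lam)).Nonempty

/-- `X'` is one of the sets of axes obtained as follows.  From a component that is not mixed, take
all axes.  From a component that is mixed of types `-1` and `2`, take the axes of type `2`.  From
any other mixed component, of types `lam` and `1 - lam`, choose one of these two types and take
the axes of that type. -/
structure IsSelectedSet (X' : Set (PrimitiveAxis F A)) : Prop where
  unmixed : ∀ Y : (axialGraph F A).ConnectedComponent, (¬ ∃ lam : F, IsMixed Y lam) →
    Y.supp ∩ X' = Y.supp
  exceptional : ∀ (Y : (axialGraph F A).ConnectedComponent) (lam : F), IsMixed Y lam →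
    (lam = -1 ∨ lam = 2) → Y.supp ∩ X' = componentOfType Y 2
  mixed : ∀ (Y : (axialGraph F A).ConnectedComponent) (lam : F), IsMixed Y lam →
    lam ≠ -1 → lam ≠ 2 →
    Y.supp ∩ X' = componentOfType Y lam ∨ Y.supp ∩ X' = componentOfType Y (1 - lam)

/-- A Frobenius form: a nonzero bilinear form that associates with the product. -/
structure IsFrobeniusForm (B : LinearMap.BilinForm F A) : Prop where
  ne_zero : B ≠ 0
  assoc : ∀ x y z : A, B x (y * z) = B (x * y) z

/-- A Frobenius form normalized with respect to `X'`: all axes in `X'` have norm `1`. -/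
structure IsNormalizedFrobeniusForm (X' : Set (PrimitiveAxis F A)) (B : LinearMap.BilinForm F A) :
    Prop extends IsFrobeniusForm B where
  norm_one : ∀ a ∈ X', B (a : A) (a : A) = 1

end AxialAlgebras

/-! An axis `a` of type (λ,δ) acts by au = φ_a(u)a + λu₁ and ua = φ_a(u)a + δu₁, where u₁ is the odd
part of u (`axis_mul`, `mul_axis`). If the odd part of an axis b ≠ a vanishes, then ab = ba = 0
(`eq_or_mul_eq_zero`), so the edges of the axial graph are exactly the nonzero odd parts. Computing
products of two adjacent axes in both decompositions (`noncommutative_pair`, `commutative_pair`)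
gives φ_a(b) = φ_b(a), with one exception: for commutative types λ and 1 - λ, λ ≠ 1/2, one has
2φ_a(b) = 2 - λ and 2φ_b(a) = 1 + λ. A selected set keeps one of the two types in each mixed
component, so φ is symmetric on it (`axisProj_comm`).

Spanning: u₁ is half of u minus its Miyamoto reflection, so the span of all axes is closed under
products. In a mixed component, a discarded axis `a` of type λ ≠ 2 is adjacent to a kept axis b
(`IsMixed.exists_adj`), and since φ_a(b) ≠ 0 it lies in the span of b and two reflections of it
(`mem_of_miyamoto_mem`). For λ = 2 ≠ -1 the coefficient φ_a(b) is 0, which is why type 2 must be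
kept.

The form: symmetry of φ on a spanning set makes (a,u) = φ_a(u) well defined (`exists_form`). It is
invariant under Miyamoto involutions, so even and odd parts of an axis are orthogonal, and
associativity reduces to (λ - δ)(x₁,z₁) = 0. This has content only for λ ≠ δ, where the odd part is
totally isotropic (`form_odd_odd`). Conversely (a,u) = φ_a(u)(a,a) for every Frobenius form
(`IsFrobeniusForm.apply_axis`), whence uniqueness.

An axis `a` that can never be selected has type -1 and a neighbour b of type 2. Then φ_b(a) = 0 and
2φ_a(b) = 3 ≠ 0, so evaluating (a,b) from both sides gives (a,a) = 0, and `a` is in the radical. -/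

section JordanType

variable {F : Type*} [Field F] {A : Type*} [NonUnitalNonAssocRing A] [Module F A]
  [IsScalarTower F A A] [SMulCommClass F A A]

/-! ### One axis: decomposition, projections, Miyamoto involution. -/

omit [IsScalarTower F A A] in
theorem mem_leftEigenspace {a x : A} {μ : F} : x ∈ leftEigenspace F a μ ↔ a * x = μ • x := by
  simp [leftEigenspace]

omit [SMulCommClass F A A] in
theorem mem_rightEigenspace {a x : A} {μ : F} : x ∈ rightEigenspace F a μ ↔ x * a = μ • x := by
  simp [rightEigenspace]

namespace IsPrimitiveAxisOfType

variable {a b : A} {l d l' d' : F}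

theorem right_independent (ha : IsPrimitiveAxisOfType a l d) {c : F} {z o : A}
    (hz : z * a = 0) (ho : o * a = d • o) (h : c • a + z + o = 0) :
    c = 0 ∧ z = 0 ∧ o = 0 := by
  have h1 : c • a + d • o = 0 := by
    have := congrArg (· * a) h
    simpa [add_mul, smul_mul_assoc, ha.idem, hz, ho] using this
  have h2 : c • a + (d * d) • o = 0 := by
    have := congrArg (· * a) h1
    simpa [add_mul, smul_mul_assoc, ha.idem, ho, smul_smul] using this
  have h3 : (d * (d - 1)) • o = 0 := by
    have e : (d * (d - 1)) • o = (c • a + (d * d) • o) - (c • a + d • o) := by module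
    rw [e, h1, h2, sub_zero]
  have o0 : o = 0 := by
    rcases smul_eq_zero.1 h3 with h | h
    · exact absurd h (mul_ne_zero ha.del_ne_zero (sub_ne_zero.2 ha.del_ne_one))
    · exact h
  have c0 : c = 0 := by
    rw [o0, smul_zero, add_zero] at h1
    exact (smul_eq_zero.1 h1).resolve_right ha.ne_zero
  refine ⟨c0, ?_, o0⟩
  simpa [c0, o0] using h

/-- Since L_a and R_a commute, the right components of a left eigenvector are left eigenvectors for
the same eigenvalue. The unwanted mixed components vanish by `lam_zero` and `zero_del`, and
primitivity excludes a component along `a`. -/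
theorem exists_decomposition (ha : IsPrimitiveAxisOfType a l d) (y : A) :
    ∃ (c : F) (z o : A), y = c • a + z + o ∧ a * z = 0 ∧ z * a = 0 ∧ a * o = l • o ∧
      o * a = d • o := by
  have left (y : A) : ∃ (c : F) (z o : A), y = c • a + z + o ∧ a * z = 0 ∧ a * o = l • o := by
    have hy : y ∈ (leftEigenspace F a 1 ⊔ leftEigenspace F a 0) ⊔ leftEigenspace F a l := by
      rw [ha.left_grading.isCompl.sup_eq_top]; trivial
    obtain ⟨e, he, o, ho, rfl⟩ := Submodule.mem_sup.1 hy
    obtain ⟨s, hs, z, hz, rfl⟩ := Submodule.mem_sup.1 he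
    rw [ha.left_primitive] at hs
    obtain ⟨c, rfl⟩ := Submodule.mem_span_singleton.1 hs
    exact ⟨c, z, o, rfl, by simpa using mem_leftEigenspace.1 hz, mem_leftEigenspace.1 ho⟩
  have right (y : A) : ∃ (c : F) (z o : A), y = c • a + z + o ∧ z * a = 0 ∧ o * a = d • o := by
    have hy : y ∈ (rightEigenspace F a 1 ⊔ rightEigenspace F a 0) ⊔ rightEigenspace F a d := by
      rw [ha.right_grading.isCompl.sup_eq_top]; trivial
    obtain ⟨e, he, o, ho, rfl⟩ := Submodule.mem_sup.1 hy
    obtain ⟨s, hs, z, hz, rfl⟩ := Submodule.mem_sup.1 he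
    rw [ha.right_primitive] at hs
    obtain ⟨c, rfl⟩ := Submodule.mem_span_singleton.1 hs
    exact ⟨c, z, o, rfl, by simpa using mem_rightEigenspace.1 hz, mem_rightEigenspace.1 ho⟩
  obtain ⟨c, z, o, rfl, hz, ho⟩ := left y
  refine ⟨c, z, o, rfl, hz, ?_, ho, ?_⟩
  · obtain ⟨c', z', o', rfl, hz', ho'⟩ := right z
    have e : c' • a + a * z' + a * o' = 0 := by
      simpa [mul_add, mul_smul_comm, ha.idem] using hz
    obtain ⟨rfl, h0, h1⟩ := ha.right_independent (by rw [← ha.comm, hz', mul_zero])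
      (by rw [← ha.comm, ho', mul_smul_comm]) e
    have : o' ∈ leftEigenspace F a 0 ⊓ rightEigenspace F a d :=
      ⟨mem_leftEigenspace.2 (by simpa using h1), mem_rightEigenspace.2 ho'⟩
    rw [ha.zero_del, Submodule.mem_bot] at this
    simp [this, hz']
  · obtain ⟨c', z', o', rfl, hz', ho'⟩ := right o
    have e : (c' - l * c') • a + (a * z' - l • z') + (a * o' - l • o') = 0 := by
      simp only [mul_add, mul_smul_comm, ha.idem] at ho
      have := sub_eq_zero.2 ho
      rw [← this]; module
    obtain ⟨h2, h0, -⟩ := ha.right_independent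
      (by rw [sub_mul, ← ha.comm, smul_mul_assoc, hz', mul_zero, smul_zero, sub_zero])
      (by rw [sub_mul, ← ha.comm, smul_mul_assoc, ho', mul_smul_comm]; module) e
    have hc : c' = 0 := by
      have : (1 - l) * c' = 0 := by linear_combination h2
      exact (mul_eq_zero.1 this).resolve_left (sub_ne_zero.2 ha.lam_ne_one.symm)
    have : z' ∈ leftEigenspace F a l ⊓ rightEigenspace F a 0 :=
      ⟨mem_leftEigenspace.2 (sub_eq_zero.1 h0), mem_rightEigenspace.2 (by simpa using hz')⟩
    rw [ha.lam_zero, Submodule.mem_bot] at this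
    simp [this, hc, ho']

theorem axisProj_decomposition (ha : IsPrimitiveAxisOfType a l d) (c : F) {z o : A}
    (h₁ : a * z = 0) (h₂ : z * a = 0) (h₃ : a * o = l • o) (h₄ : o * a = d • o) :
    axisProj F a (c • a + z + o) = c :=
  axisProj_eq F ha c ⟨mem_leftEigenspace.2 (by simpa using h₁),
    mem_rightEigenspace.2 (by simpa using h₂)⟩
    ⟨mem_leftEigenspace.2 h₃, mem_rightEigenspace.2 h₄⟩

/-- The linear functional giving the coefficient of the axis `a`. -/
noncomputable def coeff (ha : IsPrimitiveAxisOfType a l d) : A →ₗ[F] F where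
  toFun := axisProj F a
  map_add' x y := by
    obtain ⟨c, z, o, rfl, h1, h2, h3, h4⟩ := ha.exists_decomposition x
    obtain ⟨c', z', o', rfl, h1', h2', h3', h4'⟩ := ha.exists_decomposition y
    have e : c • a + z + o + (c' • a + z' + o') = (c + c') • a + (z + z') + (o + o') := by module
    rw [e, ha.axisProj_decomposition c h1 h2 h3 h4, ha.axisProj_decomposition c' h1' h2' h3' h4',
      ha.axisProj_decomposition]
    · rw [mul_add, h1, h1', add_zero]
    · rw [add_mul, h2, h2', add_zero]
    · rw [mul_add, h3, h3', smul_add]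
    · rw [add_mul, h4, h4', smul_add]
  map_smul' r x := by
    obtain ⟨c, z, o, rfl, h1, h2, h3, h4⟩ := ha.exists_decomposition x
    have e : r • (c • a + z + o) = (r * c) • a + r • z + r • o := by module
    rw [e, ha.axisProj_decomposition c h1 h2 h3 h4, ha.axisProj_decomposition]
    · rfl
    · rw [mul_smul_comm, h1, smul_zero]
    · rw [smul_mul_assoc, h2, smul_zero]
    · rw [mul_smul_comm, h3, smul_comm]
    · rw [smul_mul_assoc, h4, smul_comm]

theorem coeff_apply (ha : IsPrimitiveAxisOfType a l d) (y : A) : ha.coeff y = axisProj F a y := rfl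

/-- The projection to the odd part `A_{l,d}(a)`. -/
noncomputable def odd (ha : IsPrimitiveAxisOfType a l d) : A →ₗ[F] A :=
  l⁻¹ • (LinearMap.mulLeft F a - ha.coeff.smulRight a)

theorem odd_decomposition (ha : IsPrimitiveAxisOfType a l d) (c : F) {z o : A}
    (h₁ : a * z = 0) (h₂ : z * a = 0) (h₃ : a * o = l • o) (h₄ : o * a = d • o) :
    ha.odd (c • a + z + o) = o := by
  simp only [odd, LinearMap.smul_apply, LinearMap.sub_apply, LinearMap.mulLeft_apply,
    LinearMap.smulRight_apply, coeff_apply, ha.axisProj_decomposition c h₁ h₂ h₃ h₄, mul_add,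
    mul_smul_comm, ha.idem, h₁, h₃, add_zero, add_sub_cancel_left]
  exact inv_smul_smul₀ ha.lam_ne_zero o

theorem decomposition (ha : IsPrimitiveAxisOfType a l d) (y : A) :
    ∃ z : A, y = ha.coeff y • a + z + ha.odd y ∧ a * z = 0 ∧ z * a = 0 ∧
      a * ha.odd y = l • ha.odd y ∧ ha.odd y * a = d • ha.odd y := by
  obtain ⟨c, z, o, rfl, h1, h2, h3, h4⟩ := ha.exists_decomposition y
  refine ⟨z, ?_⟩
  rw [coeff_apply, ha.axisProj_decomposition c h1 h2 h3 h4, ha.odd_decomposition c h1 h2 h3 h4]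
  exact ⟨rfl, h1, h2, h3, h4⟩

theorem coeff_eq (ha : IsPrimitiveAxisOfType a l d) {y z o : A} {c : F} (h : y = c • a + z + o)
    (h₁ : a * z = 0) (h₂ : z * a = 0) (h₃ : a * o = l • o) (h₄ : o * a = d • o) :
    ha.coeff y = c := by
  rw [h, coeff_apply, ha.axisProj_decomposition c h₁ h₂ h₃ h₄]

theorem odd_eq (ha : IsPrimitiveAxisOfType a l d) {y z o : A} {c : F} (h : y = c • a + z + o)
    (h₁ : a * z = 0) (h₂ : z * a = 0) (h₃ : a * o = l • o) (h₄ : o * a = d • o) :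
    ha.odd y = o := by
  rw [h, ha.odd_decomposition c h₁ h₂ h₃ h₄]

theorem axis_mul (ha : IsPrimitiveAxisOfType a l d) (y : A) :
    a * y = ha.coeff y • a + l • ha.odd y := by
  obtain ⟨z, h, h1, h2, h3, h4⟩ := ha.decomposition y
  conv_lhs => rw [h]
  simp [mul_add, mul_smul_comm, ha.idem, h1, h3]

theorem mul_axis (ha : IsPrimitiveAxisOfType a l d) (y : A) :
    y * a = ha.coeff y • a + d • ha.odd y := by
  obtain ⟨z, h, h1, h2, h3, h4⟩ := ha.decomposition y
  conv_lhs => rw [h]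
  simp [add_mul, smul_mul_assoc, ha.idem, h2, h4]

theorem axis_mul_odd (ha : IsPrimitiveAxisOfType a l d) (y : A) :
    a * ha.odd y = l • ha.odd y := (ha.decomposition y).choose_spec.2.2.2.1

theorem odd_mul_axis (ha : IsPrimitiveAxisOfType a l d) (y : A) :
    ha.odd y * a = d • ha.odd y := (ha.decomposition y).choose_spec.2.2.2.2

theorem coeff_odd (ha : IsPrimitiveAxisOfType a l d) (y : A) : ha.coeff (ha.odd y) = 0 :=
  ha.coeff_eq (z := 0) (c := 0) (o := ha.odd y) (by simp) (by simp) (by simp)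
    (ha.axis_mul_odd y) (ha.odd_mul_axis y)

theorem odd_odd (ha : IsPrimitiveAxisOfType a l d) (y : A) : ha.odd (ha.odd y) = ha.odd y :=
  ha.odd_eq (z := 0) (c := 0) (o := ha.odd y) (by simp) (by simp) (by simp)
    (ha.axis_mul_odd y) (ha.odd_mul_axis y)

theorem coeff_self (ha : IsPrimitiveAxisOfType a l d) : ha.coeff a = 1 :=
  ha.coeff_eq (z := 0) (c := 1) (o := 0) (by simp) (by simp) (by simp) (by simp) (by simp)

theorem odd_self (ha : IsPrimitiveAxisOfType a l d) : ha.odd a = 0 :=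
  ha.odd_eq (z := 0) (c := 1) (o := 0) (by simp) (by simp) (by simp) (by simp) (by simp)

theorem coeff_axis_mul (ha : IsPrimitiveAxisOfType a l d) (y : A) :
    ha.coeff (a * y) = ha.coeff y := by
  rw [ha.axis_mul]; simp [ha.coeff_self, ha.coeff_odd]

theorem odd_axis_mul (ha : IsPrimitiveAxisOfType a l d) (y : A) :
    ha.odd (a * y) = l • ha.odd y := by
  rw [ha.axis_mul]; simp [ha.odd_self, ha.odd_odd]

theorem odd_eq_self_iff (ha : IsPrimitiveAxisOfType a l d) {y : A} :
    ha.odd y = y ↔ y ∈ leftEigenspace F a l := by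
  rw [mem_leftEigenspace]
  constructor
  · intro h
    rw [← h, ha.axis_mul_odd]
  · intro h
    have hc : ha.coeff y = 0 := by
      have := congrArg ha.coeff h
      rw [ha.coeff_axis_mul, map_smul, smul_eq_mul] at this
      have : (1 - l) * ha.coeff y = 0 := by linear_combination this
      exact (mul_eq_zero.1 this).resolve_left (sub_ne_zero.2 ha.lam_ne_one.symm)
    rw [ha.axis_mul, hc, zero_smul, zero_add] at h
    exact smul_right_injective A ha.lam_ne_zero h

theorem odd_eq_zero_iff (ha : IsPrimitiveAxisOfType a l d) {y : A} :
    ha.odd y = 0 ↔ y ∈ leftEigenspace F a 1 ⊔ leftEigenspace F a 0 := by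
  constructor
  · intro h
    obtain ⟨z, hy, h1, -⟩ := ha.decomposition y
    rw [hy, h, add_zero]
    refine Submodule.add_mem_sup ?_ (mem_leftEigenspace.2 (by simpa using h1))
    rw [ha.left_primitive]
    exact Submodule.smul_mem _ _ (Submodule.mem_span_singleton_self a)
  · intro h
    obtain ⟨s, hs, z, hz, rfl⟩ := Submodule.mem_sup.1 h
    rw [ha.left_primitive] at hs
    obtain ⟨c, rfl⟩ := Submodule.mem_span_singleton.1 hs
    rw [mem_leftEigenspace, zero_smul] at hz
    rw [map_add, map_smul, ha.odd_self, smul_zero, zero_add]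
    have := congrArg ha.odd hz
    rw [ha.odd_axis_mul, map_zero] at this
    exact (smul_eq_zero.1 this).resolve_left ha.lam_ne_zero

/-- The grading rules, in one identity. -/
theorem odd_mul (ha : IsPrimitiveAxisOfType a l d) (x y : A) :
    ha.odd (x * y) = (x - ha.odd x) * ha.odd y + ha.odd x * (y - ha.odd y) := by
  have even (x : A) : x - ha.odd x ∈ leftEigenspace F a 1 ⊔ leftEigenspace F a 0 :=
    ha.odd_eq_zero_iff.1 (by rw [map_sub, ha.odd_odd, sub_self])
  have od (x : A) : ha.odd x ∈ leftEigenspace F a l := ha.odd_eq_self_iff.1 (ha.odd_odd x)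
  have g := ha.left_grading
  have e : x * y = (x - ha.odd x) * (y - ha.odd y) + ha.odd x * ha.odd y
      + ((x - ha.odd x) * ha.odd y + ha.odd x * (y - ha.odd y)) := by
    simp only [sub_mul, mul_sub]; abel
  conv_lhs => rw [e]
  rw [map_add, map_add, ha.odd_eq_zero_iff.2 (g.even_mul_even _ (even x) _ (even y)),
    ha.odd_eq_zero_iff.2 (g.odd_mul_odd _ (od x) _ (od y)), map_add,
    ha.odd_eq_self_iff.2 (g.even_mul_odd _ (even x) _ (od y)),
    ha.odd_eq_self_iff.2 (g.odd_mul_even _ (od x) _ (even y))]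
  simp

theorem odd_odd_mul_odd (ha : IsPrimitiveAxisOfType a l d) (x y : A) :
    ha.odd (ha.odd x * ha.odd y) = 0 := by
  rw [ha.odd_mul, ha.odd_odd, ha.odd_odd]; simp

/-- The Miyamoto involution of an axis. -/
noncomputable def miyamoto (ha : IsPrimitiveAxisOfType a l d) : A →ₗ[F] A :=
  LinearMap.id - (2 : F) • ha.odd

theorem miyamoto_apply (ha : IsPrimitiveAxisOfType a l d) (x : A) :
    ha.miyamoto x = x - (2 : F) • ha.odd x := rfl

theorem miyamoto_miyamoto (ha : IsPrimitiveAxisOfType a l d) (x : A) :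
    ha.miyamoto (ha.miyamoto x) = x := by
  simp only [miyamoto_apply, map_sub, map_smul, ha.odd_odd]; module

theorem miyamoto_mul (ha : IsPrimitiveAxisOfType a l d) (x y : A) :
    ha.miyamoto (x * y) = ha.miyamoto x * ha.miyamoto y := by
  simp only [miyamoto_apply, ha.odd_mul, sub_mul, mul_sub, smul_mul_assoc, mul_smul_comm]
  module

/-- The Miyamoto involution, as a linear equivalence. -/
noncomputable def miyamotoEquiv (ha : IsPrimitiveAxisOfType a l d) : A ≃ₗ[F] A :=
  LinearEquiv.ofInvolutive ha.miyamoto ha.miyamoto_miyamoto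

end IsPrimitiveAxisOfType

/-! ### Transport along automorphisms, and uniqueness of types. -/

omit [IsScalarTower F A A] [SMulCommClass F A A] in
theorem IsZ2Grading.map {V₀ V₁ : Submodule F A} (h : IsZ2Grading V₀ V₁) (σ : A ≃ₗ[F] A)
    (hσ : ∀ x y, σ (x * y) = σ x * σ y) :
    IsZ2Grading (V₀.map (σ : A →ₗ[F] A)) (V₁.map (σ : A →ₗ[F] A)) where
  isCompl := h.isCompl.map (Submodule.orderIsoMapComap σ)
  even_mul_even := by
    rintro _ ⟨x, hx, rfl⟩ _ ⟨y, hy, rfl⟩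
    exact ⟨x * y, h.even_mul_even x hx y hy, hσ x y⟩
  even_mul_odd := by
    rintro _ ⟨x, hx, rfl⟩ _ ⟨y, hy, rfl⟩
    exact ⟨x * y, h.even_mul_odd x hx y hy, hσ x y⟩
  odd_mul_even := by
    rintro _ ⟨x, hx, rfl⟩ _ ⟨y, hy, rfl⟩
    exact ⟨x * y, h.odd_mul_even x hx y hy, hσ x y⟩
  odd_mul_odd := by
    rintro _ ⟨x, hx, rfl⟩ _ ⟨y, hy, rfl⟩
    exact ⟨x * y, h.odd_mul_odd x hx y hy, hσ x y⟩

omit [IsScalarTower F A A] in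
theorem leftEigenspace_map (σ : A ≃ₗ[F] A) (hσ : ∀ x y, σ (x * y) = σ x * σ y) (a : A) (μ : F) :
    leftEigenspace F (σ a) μ = (leftEigenspace F a μ).map (σ : A →ₗ[F] A) := by
  ext x
  obtain ⟨x, rfl⟩ := σ.surjective x
  rw [mem_leftEigenspace, ← hσ, ← map_smul, σ.injective.eq_iff, ← mem_leftEigenspace]
  exact ⟨fun h => ⟨x, h, rfl⟩, fun ⟨y, hy, e⟩ => σ.injective e ▸ hy⟩

omit [SMulCommClass F A A] in
theorem rightEigenspace_map (σ : A ≃ₗ[F] A) (hσ : ∀ x y, σ (x * y) = σ x * σ y) (a : A) (μ : F) :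
    rightEigenspace F (σ a) μ = (rightEigenspace F a μ).map (σ : A →ₗ[F] A) := by
  ext x
  obtain ⟨x, rfl⟩ := σ.surjective x
  rw [mem_rightEigenspace, ← hσ, ← map_smul, σ.injective.eq_iff, ← mem_rightEigenspace]
  exact ⟨fun h => ⟨x, h, rfl⟩, fun ⟨y, hy, e⟩ => σ.injective e ▸ hy⟩

namespace IsPrimitiveAxisOfType

variable {a b : A} {l d l' d' : F}

theorem map (ha : IsPrimitiveAxisOfType a l d) (σ : A ≃ₗ[F] A)
    (hσ : ∀ x y, σ (x * y) = σ x * σ y) : IsPrimitiveAxisOfType (σ a) l d where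
  ne_zero := (map_ne_zero_iff σ σ.injective).2 ha.ne_zero
  idem := by rw [← hσ, ha.idem]
  lam_ne_zero := ha.lam_ne_zero
  lam_ne_one := ha.lam_ne_one
  del_ne_zero := ha.del_ne_zero
  del_ne_one := ha.del_ne_one
  left_primitive := by
    rw [leftEigenspace_map σ hσ, ha.left_primitive, Submodule.map_span, Set.image_singleton]; rfl
  right_primitive := by
    rw [rightEigenspace_map σ hσ, ha.right_primitive, Submodule.map_span, Set.image_singleton]; rfl
  left_grading := by
    simp only [leftEigenspace_map σ hσ, ← Submodule.map_sup]
    exact ha.left_grading.map σ hσ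
  right_grading := by
    simp only [rightEigenspace_map σ hσ, ← Submodule.map_sup]
    exact ha.right_grading.map σ hσ
  comm y := by
    obtain ⟨y, rfl⟩ := σ.surjective y
    simp only [← hσ, ha.comm]
  lam_zero := by
    rw [leftEigenspace_map σ hσ, rightEigenspace_map σ hσ,
      ← Submodule.map_inf _ σ.injective, ha.lam_zero, Submodule.map_bot]
  zero_del := by
    rw [leftEigenspace_map σ hσ, rightEigenspace_map σ hσ,
      ← Submodule.map_inf _ σ.injective, ha.zero_del, Submodule.map_bot]

theorem axisProj_map (ha : IsPrimitiveAxisOfType a l d) (σ : A ≃ₗ[F] A)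
    (hσ : ∀ x y, σ (x * y) = σ x * σ y) (u : A) : axisProj F (σ a) (σ u) = axisProj F a u := by
  obtain ⟨c, z, o, rfl, h1, h2, h3, h4⟩ := ha.exists_decomposition u
  rw [ha.axisProj_decomposition c h1 h2 h3 h4, map_add, map_add, map_smul]
  apply (ha.map σ hσ).axisProj_decomposition
  · rw [← hσ, h1, map_zero]
  · rw [← hσ, h2, map_zero]
  · rw [← hσ, h3, map_smul]
  · rw [← hσ, h4, map_smul]

/-- A nonzero odd part is an eigenvector of L_a and R_a with eigenvalues `l`, `d` outside {0,1}, and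
any other type of `a` must account for them. Without an odd part the type is not determined. -/
theorem type_unique (ha : IsPrimitiveAxisOfType a l d) (ha' : IsPrimitiveAxisOfType a l' d')
    {y : A} (h : ha.odd y ≠ 0) : l' = l ∧ d' = d := by
  set n := ha.odd y with hn
  have h1 : a * n = l • n := ha.axis_mul_odd y
  have h2 : n * a = d • n := ha.odd_mul_axis y
  obtain ⟨z, e, hz, -, -, -⟩ := ha'.decomposition n
  have hc : ha'.coeff n = 0 := by
    have := congrArg ha'.coeff h1
    rw [ha'.coeff_axis_mul, map_smul, smul_eq_mul] at this
    have : (1 - l) * ha'.coeff n = 0 := by linear_combination this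
    exact (mul_eq_zero.1 this).resolve_left (sub_ne_zero.2 ha.lam_ne_one.symm)
  have h3 : l' • ha'.odd n = l • n := by rw [← h1, ha'.axis_mul, hc, zero_smul, zero_add]
  have h4 : d' • ha'.odd n = d • n := by rw [← h2, ha'.mul_axis, hc, zero_smul, zero_add]
  have h5 : ha'.odd n ≠ 0 := by
    intro h0
    rw [h0, smul_zero] at h3
    exact (smul_eq_zero.1 h3.symm).elim ha.lam_ne_zero h
  have h6 : (l' - l) • ha'.odd n = 0 := by
    have := congrArg ha'.odd h3
    rw [map_smul, map_smul, ha'.odd_odd] at this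
    rw [sub_smul, this, sub_self]
  have h7 : (d' - d) • ha'.odd n = 0 := by
    have := congrArg ha'.odd h4
    rw [map_smul, map_smul, ha'.odd_odd] at this
    rw [sub_smul, this, sub_self]
  exact ⟨sub_eq_zero.1 ((smul_eq_zero.1 h6).resolve_right h5),
    sub_eq_zero.1 ((smul_eq_zero.1 h7).resolve_right h5)⟩

end IsPrimitiveAxisOfType

/-! ### Pairs of axes. -/

namespace IsPrimitiveAxisOfType

variable {a b c : A} {l d l' d' : F}

theorem coeff_odd_eq_zero_of_mul (ha : IsPrimitiveAxisOfType a l d) {y : A} (h : a * y = 0) :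
    ha.coeff y = 0 ∧ ha.odd y = 0 := by
  constructor
  · rw [← ha.coeff_axis_mul, h, map_zero]
  · have := ha.odd_axis_mul y
    rw [h, map_zero] at this
    exact (smul_eq_zero.1 this.symm).resolve_left ha.lam_ne_zero

theorem eq_or_mul_eq_zero (ha : IsPrimitiveAxisOfType a l d) (hb : IsPrimitiveAxisOfType b l' d')
    (h : ha.odd b = 0) : a = b ∨ (a * b = 0 ∧ b * a = 0) := by
  have ab := ha.axis_mul b
  have ba := ha.mul_axis b
  have ba' := hb.axis_mul a
  rw [h, smul_zero, add_zero] at ab ba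
  rw [ba] at ba'
  have hm : hb.odd a = 0 := by
    by_contra hm
    have h1 : ha.coeff b • hb.odd a = l' • hb.odd a := by
      simpa [hb.odd_self, hb.odd_odd] using congrArg hb.odd ba'
    have h2 : ha.coeff b = l' := smul_left_injective F hm h1
    have h3 : ha.coeff b * hb.coeff a = hb.coeff a := by
      simpa [hb.coeff_self, hb.coeff_odd] using congrArg hb.coeff ba'
    have h4 : hb.coeff a = 0 := by
      rw [h2] at h3
      have : (1 - l') * hb.coeff a = 0 := by linear_combination -h3
      exact (mul_eq_zero.1 this).resolve_left (sub_ne_zero.2 hb.lam_ne_one.symm)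
    rw [h2, h4, zero_smul, zero_add] at ba'
    have h5 : a = hb.odd a := smul_right_injective A hb.lam_ne_zero ba'
    -- Now `a` is odd for `b`, but a = a² is a product of odd elements, hence even.
    have h6 := hb.odd_odd_mul_odd a a
    rw [← h5, ha.idem] at h6
    exact hm h6
  rw [hm, smul_zero, add_zero] at ba'
  by_cases h0 : ha.coeff b = 0
  · right
    rw [ab, ba, h0, zero_smul]
    exact ⟨rfl, rfl⟩
  · left
    have h1 : ha.coeff b = hb.coeff a * ha.coeff b := by
      simpa [ha.coeff_self] using congrArg ha.coeff ba'
    have h2 : hb.coeff a = 1 := mul_right_cancel₀ h0 (by rw [one_mul, ← h1])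
    have h3 : ha.coeff b * hb.coeff a = hb.coeff a := by
      simpa [hb.coeff_self] using congrArg hb.coeff ba'
    rw [h2, mul_one] at h3
    simpa [h2, h3] using ba'

/-- The grading identity `odd_mul` applied to the idempotent b = b². -/
theorem mul_odd_add_odd_mul (ha : IsPrimitiveAxisOfType a l d) (hb : b * b = b) :
    b * ha.odd b + ha.odd b * b = ha.odd b + (2 : F) • (ha.odd b * ha.odd b) := by
  have h := ha.odd_mul b b
  rw [hb, sub_mul, mul_sub] at h
  have e : b * ha.odd b + ha.odd b * b = (b * ha.odd b - ha.odd b * ha.odd b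
      + (ha.odd b * b - ha.odd b * ha.odd b)) + (2 : F) • (ha.odd b * ha.odd b) := by module
  rw [e, ← h]

theorem odd_mul_odd_add_odd_mul (ha : IsPrimitiveAxisOfType a l d) (hb : b * b = b) :
    ha.odd (b * ha.odd b + ha.odd b * b) = ha.odd b := by
  rw [ha.mul_odd_add_odd_mul hb, map_add, map_smul, ha.odd_odd, ha.odd_odd_mul_odd, smul_zero,
    add_zero]

/-- Two noncommuting primitive axes. -/
theorem noncommutative_pair (ha : IsPrimitiveAxisOfType a l d)
    (hb : IsPrimitiveAxisOfType b l' d') (hld : l ≠ d) (hn : ha.odd b ≠ 0) :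
    l + d = 1 ∧ l' ≠ d' ∧ hb.odd a ≠ 0 ∧
    ((l' = l ∧ d' = d ∧ ha.coeff b = 1 ∧ hb.coeff a = 1 ∧ ha.odd b = b - a) ∨
    (l' = d ∧ d' = l ∧ ha.coeff b = 0 ∧ hb.coeff a = 0 ∧ hb.odd a = ha.odd b)) := by
  have e1 : ha.coeff b • a + l • ha.odd b = hb.coeff a • b + d' • hb.odd a := by
    rw [← ha.axis_mul, ← hb.mul_axis]
  have e2 : ha.coeff b • a + d • ha.odd b = hb.coeff a • b + l' • hb.odd a := by
    rw [← hb.axis_mul, ← ha.mul_axis]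
  -- The commutator of `a` and `b`, computed for each axis: the two odd parts are proportional, with
  -- ratio `r` below.
  have e3 : (l - d) • ha.odd b = (d' - l') • hb.odd a := by linear_combination (norm := module) e1 - e2
  have hld' : l - d ≠ 0 := sub_ne_zero.2 hld
  have h0 : (d' - l') • hb.odd a ≠ 0 := by
    rw [← e3]; exact smul_ne_zero hld' hn
  have hm : hb.odd a ≠ 0 := fun h => h0 (by rw [h, smul_zero])
  have hdl : d' - l' ≠ 0 := fun h => h0 (by rw [h, zero_smul])
  obtain ⟨r, hr⟩ : ∃ r : F, (l - d) * r = d' - l' :=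
    ⟨(d' - l') / (l - d), by field_simp⟩
  have hr0 : r ≠ 0 := fun h => hdl (by rw [← hr, h, mul_zero])
  have enm : ha.odd b = r • hb.odd a := by
    apply smul_right_injective A hld'
    simp only [smul_smul, hr, e3]
  have e4 : ha.coeff b • a - hb.coeff a • b = (d' - l * r) • hb.odd a := by
    rw [enm] at e1
    linear_combination (norm := module) e1
  have c1 : ha.coeff b = d' - l * r := by
    apply smul_left_injective F hm
    simpa [hb.odd_self, hb.odd_odd] using congrArg hb.odd e4
  have c2 : ha.coeff b * hb.coeff a - hb.coeff a = 0 := by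
    simpa [hb.coeff_self, hb.coeff_odd] using congrArg hb.coeff e4
  have e5 : (ha.coeff b * r) • a - (hb.coeff a * r) • b = (d' - l * r) • ha.odd b := by
    rw [enm]; linear_combination (norm := module) r • e4
  have c3 : -(hb.coeff a * r) = d' - l * r := by
    apply smul_left_injective F hn
    simpa [ha.odd_self, ha.odd_odd] using congrArg ha.odd e5
  -- The two goals left, l + d = 1 and the dichotomy, need the same case split on φ_b(a); `first`
  -- closes whichever is at hand.
  refine ⟨?_, fun h => hdl (by rw [h, sub_self]), hm, ?_⟩ <;>
  · by_cases hψ : hb.coeff a = 0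
    · have hφ : ha.coeff b = 0 := by rw [c1, ← c3, hψ]; simp
      have d1 : d' = l * r := by rw [hφ] at c1; exact (sub_eq_zero.1 c1.symm)
      have d2 : l' = d * r := by linear_combination d1 + hr
      have s1 : l' + d' = 1 := by
        have := ha.odd_mul_odd_add_odd_mul hb.idem
        rw [enm, mul_smul_comm, smul_mul_assoc, hb.axis_mul_odd, hb.odd_mul_axis, smul_comm r l',
          smul_comm r d', ← enm, map_add, map_smul, map_smul, ha.odd_odd, ← add_smul] at this
        exact smul_left_injective F hn (by simpa using this)
      have emn : hb.odd a = r⁻¹ • ha.odd b := by rw [enm, inv_smul_smul₀ hr0]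
      have s2 : l + d = 1 := by
        have := hb.odd_mul_odd_add_odd_mul ha.idem
        rw [emn, mul_smul_comm, smul_mul_assoc, ha.axis_mul_odd, ha.odd_mul_axis, smul_comm _ l,
          smul_comm _ d, ← emn, map_add, map_smul, map_smul, hb.odd_odd, ← add_smul] at this
        exact smul_left_injective F hm (by simpa using this)
      have r1 : r = 1 := by linear_combination s1 - d1 - d2 - r * s2
      subst r1
      first
        | exact s2
        | exact Or.inr ⟨by rw [d2, mul_one], by rw [d1, mul_one], hφ, hψ, by rw [enm, one_smul]⟩
    · have hφ : ha.coeff b = 1 := by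
        apply mul_right_cancel₀ hψ
        linear_combination c2
      have c4 : ha.coeff b * r - hb.coeff a * r * ha.coeff b = 0 := by
        simpa [ha.coeff_self, ha.coeff_odd] using congrArg ha.coeff e5
      have hψ1 : hb.coeff a = 1 := by
        rw [hφ] at c4
        apply mul_right_cancel₀ hr0
        linear_combination -c4
      have r1 : r = -1 := by rw [hψ1] at c3; linear_combination -c3 + c1 - hφ
      have hnb : ha.odd b = b - a := by
        rw [hφ, hψ1, ← c1, hφ] at e4
        rw [enm, r1]
        linear_combination (norm := module) e4
      have s : l + d = 1 := by
        have := ha.odd_odd_mul_odd b b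
        have e : ha.odd b * ha.odd b = b - b * a - a * b + a := by
          rw [hnb, sub_mul, mul_sub, mul_sub, ha.idem, hb.idem]; abel
        rw [e, ha.mul_axis, ha.axis_mul] at this
        simp only [map_add, map_sub, map_smul, ha.odd_self, ha.odd_odd] at this
        have h2 : (1 - d - l) • ha.odd b = 0 := by linear_combination (norm := module) this
        linear_combination -(smul_eq_zero.1 h2).resolve_right hn
      rw [hφ] at c1
      rw [r1] at c1 hr
      first
        | exact s
        | exact Or.inl ⟨by linear_combination hr - c1 - s, by linear_combination -c1 - s,
            hφ, hψ1, hnb⟩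

/-! ### Pairs of axes of commutative type. -/

section Commutative

theorem left_mul_eq_right_mul (ha : IsPrimitiveAxisOfType a l l) (y : A) : a * y = y * a := by
  rw [ha.axis_mul, ha.mul_axis]

theorem smul_odd (ha : IsPrimitiveAxisOfType a l d) (y : A) :
    l • ha.odd y = a * y - ha.coeff y • a := by rw [ha.axis_mul]; abel

theorem axis_mul_axis_mul (ha : IsPrimitiveAxisOfType a l d) (y : A) :
    a * (a * y) = l • (a * y) + ((1 - l) * ha.coeff y) • a := by
  rw [ha.axis_mul y, mul_add, mul_smul_comm, mul_smul_comm, ha.idem, ha.axis_mul_odd]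
  module

variable (ha : IsPrimitiveAxisOfType a l l) (hb : IsPrimitiveAxisOfType b l' l')

include ha hb

theorem smul_mul_odd :
    l • (b * ha.odd b) = (l' - ha.coeff b) • (a * b) + ((1 - l') * hb.coeff a) • b := by
  rw [← mul_smul_comm, ha.smul_odd, ha.left_mul_eq_right_mul b, mul_sub, hb.axis_mul_axis_mul,
    mul_smul_comm]
  module

theorem two_smul_mul_odd :
    (2 : F) • (b * ha.odd b) = ha.odd b + (2 : F) • (ha.odd b * ha.odd b) := by
  rw [← ha.mul_odd_add_odd_mul hb.idem, hb.left_mul_eq_right_mul, two_smul]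

/-- Take odd parts for `a` in the two expressions for the product of `b` with its own odd part, and
cancel `ha.odd b`. -/
theorem coeff_relation (hn : ha.odd b ≠ 0) :
    2 * ((l' - ha.coeff b) * l + (1 - l') * hb.coeff a) = l := by
  have h1 := congrArg ha.odd (smul_mul_odd ha hb)
  have h2 := congrArg ha.odd (two_smul_mul_odd ha hb)
  simp only [map_smul, map_add, ha.odd_axis_mul, ha.odd_odd, ha.odd_odd_mul_odd, smul_zero,
    add_zero] at h1 h2
  apply smul_left_injective F hn
  show (2 * ((l' - ha.coeff b) * l + (1 - l') * hb.coeff a)) • ha.odd b = l • ha.odd b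
  linear_combination (norm := module) (-2 : F) • h1 + l • h2

/-- The left side is symmetric in `a` and `b`, the right side is not; comparing with the swapped
identity yields a linear relation among ab, a, b. -/
theorem two_smul_mul_mul :
    (2 : F) • ((a * b) * (a * b)) = (2 * l * (l' - ha.coeff b) - l + 4 * ha.coeff b * l) • (a * b)
      + (2 * l * (1 - l') * hb.coeff a) • b
      + (l * ha.coeff b + 2 * (1 - 2 * l) * ha.coeff b ^ 2) • a := by
  have h1 := smul_mul_odd ha hb
  have h2 := two_smul_mul_odd ha hb
  have h3 : (l * l) • (ha.odd b * ha.odd b) = (a * b) * (a * b)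
      - (2 * ha.coeff b) • (a * (a * b)) + (ha.coeff b ^ 2) • a := by
    have : (l * l) • (ha.odd b * ha.odd b) = (l • ha.odd b) * (l • ha.odd b) := by
      rw [smul_mul_assoc, mul_smul_comm, smul_smul]
    rw [this, ha.smul_odd, sub_mul, mul_sub, mul_sub, smul_mul_assoc, mul_smul_comm,
      mul_smul_comm, smul_mul_assoc, ha.idem, ← ha.left_mul_eq_right_mul (a * b)]
    module
  rw [ha.axis_mul_axis_mul] at h3
  have h4 := ha.smul_odd b
  linear_combination (norm := module) (-2 : F) • h3 - (l * l) • h2 + (2 * l) • h1 - l • h4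

/-- Odd parts for the two axes force β = l and α = l'; the coefficients then give the relations. -/
theorem relation_of_mem_span (hn : ha.odd b ≠ 0) (hm : hb.odd a ≠ 0) {α β : F}
    (h : a * b = α • a + β • b) :
    (1 - l) * ha.coeff b = l' ∧ (1 - l') * hb.coeff a = l := by
  have h1 := congrArg ha.odd h
  have h2 := congrArg ha.coeff h
  rw [ha.odd_axis_mul] at h1
  rw [ha.coeff_axis_mul] at h2
  rw [ha.left_mul_eq_right_mul] at h
  have h3 := congrArg hb.odd h
  have h4 := congrArg hb.coeff h
  rw [hb.odd_axis_mul] at h3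
  rw [hb.coeff_axis_mul] at h4
  simp only [map_add, map_smul, ha.odd_self, hb.odd_self, ha.coeff_self, hb.coeff_self,
    smul_zero, add_zero, zero_add, smul_eq_mul, mul_one] at h1 h2 h3 h4
  have hβ : l = β := smul_left_injective F hn h1
  have hα : l' = α := smul_left_injective F hm h3
  subst hβ hα
  exact ⟨by linear_combination h2, by linear_combination h4⟩

/-- Two primitive axes of commutative type with nonzero product. -/
theorem commutative_pair (h2 : (2 : F) ≠ 0) (hn : ha.odd b ≠ 0) (hm : hb.odd a ≠ 0) :
    (l = l' ∧ ha.coeff b = hb.coeff a) ∨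
    (l + l' = 1 ∧ 2 * l ≠ 1 ∧ 2 * ha.coeff b = 2 - l ∧ 2 * hb.coeff a = 2 - l') := by
  have r1 := coeff_relation ha hb hn
  have r2 := coeff_relation hb ha hm
  have p1 := two_smul_mul_mul ha hb
  have p2 := two_smul_mul_mul hb ha
  rw [← ha.left_mul_eq_right_mul b] at p2
  -- The scalar here is the difference of the coefficients of ab in `p1` and `p2`; when it is
  -- nonzero, ab lies in the span of `a` and `b`.
  have key : 2 * (l * ha.coeff b) - 2 * (l' * hb.coeff a) - (l - l') ≠ 0 →
      (1 - l) * ha.coeff b = l' ∧ (1 - l') * hb.coeff a = l := by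
    intro h
    set k := 2 * (l * ha.coeff b) - 2 * (l' * hb.coeff a) - (l - l') with hk
    obtain ⟨x, y, hxy⟩ : ∃ x y : F, k • (a * b) = x • a + y • b := by
      refine ⟨2 * l' * (1 - l) * ha.coeff b
        - (l * ha.coeff b + 2 * (1 - 2 * l) * ha.coeff b ^ 2),
        (l' * hb.coeff a + 2 * (1 - 2 * l') * hb.coeff a ^ 2)
        - 2 * l * (1 - l') * hb.coeff a, ?_⟩
      linear_combination (norm := module) p2 - p1
    refine relation_of_mem_span ha hb hn hm (α := k⁻¹ * x) (β := k⁻¹ * y) ?_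
    rw [mul_smul, mul_smul, ← smul_add, ← hxy, inv_smul_smul₀ h]
  by_cases hD : l + l' = 1
  · obtain rfl : l' = 1 - l := by linear_combination hD
    have r3 : l * (2 * hb.coeff a - 2 * ha.coeff b) = l * (2 * l - 1) := by
      linear_combination r1
    have r4 := mul_left_cancel₀ ha.lam_ne_zero r3
    by_cases hl : 2 * l = 1
    · left
      refine ⟨by linear_combination hl, ?_⟩
      apply mul_left_cancel₀ h2
      linear_combination -r4 - hl
    · right
      have hl' : 2 * l - 1 ≠ 0 := sub_ne_zero.2 hl
      have h5 : 2 * ha.coeff b = 2 - l := by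
        by_contra h
        obtain ⟨k1, k2⟩ := key (by
          have : 2 * (l * ha.coeff b) - 2 * ((1 - l) * hb.coeff a) - (l - (1 - l))
              = (2 * l - 1) * (2 * ha.coeff b - (2 - l)) := by
            linear_combination -(1 - l) * r4
          rw [this]
          exact mul_ne_zero hl' (sub_ne_zero.2 h))
        have f1 : ha.coeff b = 1 :=
          mul_left_cancel₀ (sub_ne_zero.2 ha.lam_ne_one.symm) (by linear_combination k1)
        have f2 : hb.coeff a = 1 :=
          mul_left_cancel₀ ha.lam_ne_zero (by linear_combination k2)
        rw [f1, f2] at r4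
        exact hl' (by linear_combination -r4)
      exact ⟨hD, hl, h5, by linear_combination r4 + h5⟩
  · left
    -- `r1` and `r2` form a linear system in the two coefficients with determinant 4(l + l' - 1), so
    -- its solution is unique.
    have hD' : l + l' - 1 ≠ 0 := sub_ne_zero.2 hD
    have f1 : 2 * ha.coeff b = l' := by
      apply mul_left_cancel₀ hD'
      linear_combination (-l') * r1 - (1 - l') * r2
    have f2 : 2 * hb.coeff a = l := by
      apply mul_left_cancel₀ hD'
      linear_combination (-l) * r2 - (1 - l) * r1
    have e : l = l' := by
      by_contra h
      obtain ⟨k1, k2⟩ := key (by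
        have : 2 * (l * ha.coeff b) - 2 * (l' * hb.coeff a) - (l - l') = l' - l := by
          linear_combination l * f1 - l' * f2
        rw [this]
        exact sub_ne_zero.2 (Ne.symm h))
      have g1 : 1 - l = 2 := mul_right_cancel₀ hb.lam_ne_zero (by
        linear_combination 2 * k1 - (1 - l) * f1)
      have g2 : 1 - l' = 2 := mul_right_cancel₀ ha.lam_ne_zero (by
        linear_combination 2 * k2 - (1 - l') * f2)
      exact h (by linear_combination g2 - g1)
    refine ⟨e, mul_left_cancel₀ h2 ?_⟩
    rw [f1, f2, e]

end Commutative

end IsPrimitiveAxisOfType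

/-! ### Adjacent axes of different commutative types, and reflections. -/

namespace IsPrimitiveAxisOfType

variable {a b c : A} {l d l' d' : F}

theorem mul_eq_zero_of_odd_eq_zero (ha : IsPrimitiveAxisOfType a l d)
    (hb : IsPrimitiveAxisOfType b l' d') (hab : a ≠ b) (h : ha.odd b = 0) :
    a * b = 0 ∧ b * a = 0 := (ha.eq_or_mul_eq_zero hb h).resolve_left hab

theorem odd_ne_zero_symm (ha : IsPrimitiveAxisOfType a l d)
    (hb : IsPrimitiveAxisOfType b l' d') (h : ha.odd b ≠ 0) : hb.odd a ≠ 0 := by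
  intro h0
  rcases hb.eq_or_mul_eq_zero ha h0 with rfl | ⟨-, h1⟩
  · exact h ha.odd_self
  · exact h (ha.coeff_odd_eq_zero_of_mul h1).2

theorem coeff_of_type_ne (ha : IsPrimitiveAxisOfType a l l) (hb : IsPrimitiveAxisOfType b l' l')
    (h2 : (2 : F) ≠ 0) (hl : l ≠ l') (hn : ha.odd b ≠ 0) :
    l + l' = 1 ∧ 2 * ha.coeff b = 2 - l ∧ 2 * hb.coeff a = 2 - l' := by
  rcases commutative_pair ha hb h2 hn (ha.odd_ne_zero_symm hb hn) with ⟨h, -⟩ | ⟨h1, -, h3, h4⟩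
  · exact absurd h hl
  · exact ⟨h1, h3, h4⟩

/-- The square of the odd part, for two axes of different commutative types. -/
theorem two_smul_odd_mul_odd (ha : IsPrimitiveAxisOfType a l l)
    (hb : IsPrimitiveAxisOfType b l' l') (h2 : (2 : F) ≠ 0) (hl : l ≠ l') (hn : ha.odd b ≠ 0) :
    (2 : F) • (ha.odd b * ha.odd b) =
      (2 * hb.coeff a) • (b - ha.odd b) - ha.coeff b • a := by
  obtain ⟨h, h3, h4⟩ := ha.coeff_of_type_ne hb h2 hl hn
  obtain rfl : l' = 1 - l := by linear_combination h
  have e1 := smul_mul_odd ha hb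
  have e2 := two_smul_mul_odd ha hb
  have e3 := ha.smul_odd b
  have e4 : (2 * (1 - l - ha.coeff b) + l) • (a * b) = (0 : F) • (a * b) := by
    congr 1; linear_combination -h3
  have e5 : (l * (2 * hb.coeff a)) • ha.odd b = (l * (2 - (1 - l))) • ha.odd b := by rw [h4]
  apply smul_right_injective A ha.lam_ne_zero
  show l • (2 : F) • (ha.odd b * ha.odd b) =
    l • ((2 * hb.coeff a) • (b - ha.odd b) - ha.coeff b • a)
  linear_combination (norm := module) (2 : F) • e1 - l • e2 + e4 + l • e3 + e5

/-- Shortens a path a - c - b. If both odd parts vanished, `b` and its odd part for `c` would be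
even for `a`; then so would φ_c(b)c by `two_smul_odd_mul_odd`, although φ_c(b) ≠ 0 because l' ≠ 2.
-/
theorem odd_ne_zero_or_odd_miyamoto_ne_zero (ha : IsPrimitiveAxisOfType a l d)
    (hc : IsPrimitiveAxisOfType c l' l') (hb : IsPrimitiveAxisOfType b d' d')
    (h2 : (2 : F) ≠ 0) (hl : l' ≠ d') (hl2 : l' ≠ 2) (hac : ha.odd c ≠ 0) (hcb : hc.odd b ≠ 0) :
    ha.odd b ≠ 0 ∨ ha.odd (hc.miyamoto b) ≠ 0 := by
  by_contra! hcon
  obtain ⟨h0, h1⟩ := hcon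
  rw [miyamoto_apply, map_sub, map_smul, h0, zero_sub, neg_eq_zero, smul_eq_zero] at h1
  replace h1 := h1.resolve_left h2
  have e := congrArg ha.odd (hc.two_smul_odd_mul_odd hb h2 hl hcb)
  obtain ⟨-, h3, -⟩ := hc.coeff_of_type_ne hb h2 hl hcb
  rw [map_smul, ha.odd_mul, h1, map_sub, map_smul, map_smul, map_sub, h0, h1] at e
  simp only [mul_zero, zero_mul, add_zero, smul_zero, sub_zero, zero_sub] at e
  rcases smul_eq_zero.1 (neg_eq_zero.1 e.symm) with h | h
  · rw [h, mul_zero] at h3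
    exact hl2 (by linear_combination h3)
  · exact hac h

/-- The reflections give the odd part n of `b` for `a` and the odd part of n for `b`. The latter is
-1/2 times the odd part of `a` for `b`, so ab is in `S`, and so is φ_a(b)a = ab - ln; here φ_a(b) ≠
0 because l ≠ 2. -/
theorem mem_of_miyamoto_mem (ha : IsPrimitiveAxisOfType a l l)
    (hb : IsPrimitiveAxisOfType b l' l') (h2 : (2 : F) ≠ 0) (hl : l ≠ l') (hl2 : l ≠ 2)
    (hn : ha.odd b ≠ 0) {S : Submodule F A} (h₀ : b ∈ S) (h₁ : ha.miyamoto b ∈ S)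
    (h₃ : hb.miyamoto (ha.miyamoto b) ∈ S) : a ∈ S := by
  obtain ⟨h, hφ, hψ⟩ := ha.coeff_of_type_ne hb h2 hl hn
  have hnS : ha.odd b ∈ S := by
    have := S.smul_mem (2 : F)⁻¹ (S.sub_mem h₀ h₁)
    rwa [miyamoto_apply, sub_sub_cancel, inv_smul_smul₀ h2] at this
  have hn' : hb.odd (ha.odd b) ∈ S := by
    have := S.smul_mem (4 : F)⁻¹ (S.sub_mem h₃ h₁)
    have e : hb.miyamoto (ha.miyamoto b) - ha.miyamoto b = (4 : F) • hb.odd (ha.odd b) := by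
      rw [miyamoto_apply hb, miyamoto_apply ha, map_sub, map_smul, hb.odd_self]; module
    have h4 : (4 : F) ≠ 0 := by
      have : (4 : F) = 2 * 2 := by norm_num
      rw [this]; exact mul_ne_zero h2 h2
    rwa [e, inv_smul_smul₀ h4] at this
  have em : l • hb.odd (ha.odd b) = (l' - ha.coeff b) • hb.odd a := by
    have := congrArg hb.odd (ha.smul_odd b)
    rw [ha.left_mul_eq_right_mul, map_smul, map_sub, hb.odd_axis_mul, map_smul] at this
    rw [this, sub_smul]
  have hmS : hb.odd a ∈ S := by
    have e : (2 : F) • (-hb.odd (ha.odd b)) = hb.odd a := by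
      have e' : (2 * (l' - ha.coeff b) + l) • hb.odd a = (0 : F) • hb.odd a := by
        congr 1; linear_combination 2 * h - hφ
      apply smul_right_injective A ha.lam_ne_zero
      show l • (2 : F) • (-hb.odd (ha.odd b)) = l • hb.odd a
      linear_combination (norm := module) (-2 : F) • em - e'
    rw [← e]
    exact S.smul_mem _ (S.neg_mem hn')
  have hp : a * b ∈ S := by
    rw [hb.mul_axis]
    exact S.add_mem (S.smul_mem _ h₀) (S.smul_mem _ hmS)
  have haS : ha.coeff b • a ∈ S := by
    have : ha.coeff b • a = a * b - l • ha.odd b := by rw [ha.smul_odd, sub_sub_cancel]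
    rw [this]
    exact S.sub_mem hp (S.smul_mem _ hnS)
  have hφ0 : ha.coeff b ≠ 0 := by
    intro h0
    rw [h0, mul_zero] at hφ
    exact hl2 (by linear_combination hφ)
  have := S.smul_mem (ha.coeff b)⁻¹ haS
  rwa [inv_smul_smul₀ hφ0] at this

theorem miyamoto_type (ha : IsPrimitiveAxisOfType a l d) (hb : IsPrimitiveAxisOfType b l' d') :
    IsPrimitiveAxisOfType (ha.miyamoto b) l' d' :=
  hb.map ha.miyamotoEquiv ha.miyamoto_mul

theorem odd_miyamoto (ha : IsPrimitiveAxisOfType a l d) (x : A) :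
    ha.odd (ha.miyamoto x) = -ha.odd x := by
  rw [miyamoto_apply, map_sub, map_smul, ha.odd_odd]; module

/-- The action of a Miyamoto involution on the set of primitive axes. -/
noncomputable def reflect (ha : IsPrimitiveAxisOfType a l d) (y : PrimitiveAxis F A) :
    PrimitiveAxis F A :=
  ⟨ha.miyamoto y, let ⟨m, e, hy⟩ := y.2; ⟨m, e, ha.miyamoto_type hy⟩⟩

theorem coe_reflect (ha : IsPrimitiveAxisOfType a l d) (y : PrimitiveAxis F A) :
    (ha.reflect y : A) = ha.miyamoto y := rfl

end IsPrimitiveAxisOfType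

/-! ### The axial graph, its components and mixed types. -/

section Graph

open SimpleGraph IsPrimitiveAxisOfType

theorem axialGraph_adj_iff {x y : PrimitiveAxis F A} {l d : F}
    (hx : IsPrimitiveAxisOfType (x : A) l d) : (axialGraph F A).Adj x y ↔ hx.odd y ≠ 0 := by
  obtain ⟨m, e, hy⟩ := y.2
  rw [axialGraph, SimpleGraph.fromRel_adj]
  constructor
  · rintro ⟨hxy, h⟩ h0
    obtain ⟨h1, h2⟩ := hx.mul_eq_zero_of_odd_eq_zero hy (fun h => hxy (Subtype.ext h)) h0
    exact h.elim (· h1) (· h2)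
  · intro h
    refine ⟨?_, Or.inl fun h0 => h (hx.coeff_odd_eq_zero_of_mul h0).2⟩
    rintro rfl
    exact h hx.odd_self

theorem type_of_adj (h2 : (2 : F) ≠ 0) {x y : PrimitiveAxis F A} {l : F}
    (hx : IsPrimitiveAxisOfType (x : A) l l) (h : (axialGraph F A).Adj x y) :
    IsPrimitiveAxisOfType (y : A) l l ∨ IsPrimitiveAxisOfType (y : A) (1 - l) (1 - l) := by
  obtain ⟨m, e, hy⟩ := y.2
  have hn := (axialGraph_adj_iff hx).1 h
  have hm := (axialGraph_adj_iff hy).1 h.symm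
  obtain rfl : m = e := by
    by_contra hne
    exact (hy.noncommutative_pair hx hne hm).2.1 rfl
  rcases commutative_pair hx hy h2 hn hm with ⟨rfl, -⟩ | ⟨h, -⟩
  · exact Or.inl hy
  · obtain rfl : m = 1 - l := by linear_combination h
    exact Or.inr hy

theorem connectedComponentMk_reflect {a : A} {l d : F} (ha : IsPrimitiveAxisOfType a l d)
    (y : PrimitiveAxis F A) :
    (axialGraph F A).connectedComponentMk (ha.reflect y) =
      (axialGraph F A).connectedComponentMk y := by
  let x : PrimitiveAxis F A := ⟨a, l, d, ha⟩
  have hx : IsPrimitiveAxisOfType (x : A) l d := ha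
  by_cases h : ha.odd y = 0
  · congr 1
    apply Subtype.ext
    rw [coe_reflect, miyamoto_apply, h, smul_zero, sub_zero]
  · have h1 : (axialGraph F A).Adj x y := (axialGraph_adj_iff hx).2 h
    have h3 : (axialGraph F A).Adj x (ha.reflect y) := by
      rw [axialGraph_adj_iff hx, coe_reflect]
      rw [show hx.odd (ha.miyamoto y) = -ha.odd y from ha.odd_miyamoto _]
      exact neg_ne_zero.2 h
    exact (ConnectedComponent.sound (h3.symm.reachable.trans h1.reachable))

variable {Y : (axialGraph F A).ConnectedComponent}

theorem reflect_mem_componentOfType {a : A} {l d m : F} (ha : IsPrimitiveAxisOfType a l d)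
    {y : PrimitiveAxis F A} (hy : y ∈ componentOfType Y m) :
    ha.reflect y ∈ componentOfType Y m := by
  refine ⟨?_, ha.miyamoto_type hy.2⟩
  rw [ConnectedComponent.mem_supp_iff, connectedComponentMk_reflect ha]
  exact hy.1

theorem reachable_of_mem_supp {x y : PrimitiveAxis F A} (hx : x ∈ Y.supp) (hy : y ∈ Y.supp) :
    (axialGraph F A).Reachable x y :=
  ConnectedComponent.exact (hx.trans (Eq.symm hy))

theorem mem_supp_of_adj {x y : PrimitiveAxis F A} (hx : x ∈ Y.supp)
    (h : (axialGraph F A).Adj x y) : y ∈ Y.supp :=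
  (ConnectedComponent.sound h.symm.reachable).trans hx

theorem mem_componentOfType_or (h2 : (2 : F) ≠ 0) {l : F} {x y : PrimitiveAxis F A}
    (hx : x ∈ componentOfType Y l) (hy : y ∈ Y.supp) :
    y ∈ componentOfType Y l ∨ y ∈ componentOfType Y (1 - l) := by
  have h := (SimpleGraph.reachable_iff_reflTransGen x y).1 (reachable_of_mem_supp hx.1 hy)
  clear hy
  induction h with
  | refl => exact Or.inl hx
  | tail _ hcy ih =>
    rcases ih with hc | hc
    · exact (type_of_adj h2 hc.2 hcy).imp (fun h => ⟨mem_supp_of_adj hc.1 hcy, h⟩)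
        (fun h => ⟨mem_supp_of_adj hc.1 hcy, h⟩)
    · refine (type_of_adj h2 hc.2 hcy).symm.imp (fun h => ⟨mem_supp_of_adj hc.1 hcy, ?_⟩)
        (fun h => ⟨mem_supp_of_adj hc.1 hcy, h⟩)
      rwa [sub_sub_cancel] at h

theorem exists_adj_of_ne {x y : PrimitiveAxis F A} (hx : x ∈ Y.supp) (hy : y ∈ Y.supp)
    (hxy : x ≠ y) : ∃ z, (axialGraph F A).Adj x z := by
  have h := (SimpleGraph.reachable_iff_reflTransGen x y).1 (reachable_of_mem_supp hx hy)
  rcases h.cases_head with h | ⟨z, hz, -⟩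
  · exact absurd h hxy
  · exact ⟨z, hz⟩

theorem IsMixed.symm {l : F} (h : IsMixed Y l) : IsMixed Y (1 - l) where
  ne_half := by
    intro e
    apply h.ne_half
    -- In characteristic 2 the term `1 / 2` is 0, so `e` would give l = 1.
    have h2 : (2 : F) ≠ 0 := by
      intro h0
      rw [h0, div_zero] at e
      obtain ⟨x, hx⟩ := h.nonempty_left
      exact hx.2.lam_ne_one (by linear_combination -e)
    field_simp at e ⊢
    linear_combination -e
  union_eq := by rw [sub_sub_cancel, Set.union_comm]; exact h.union_eq
  nonempty_left := h.nonempty_right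
  nonempty_right := by rw [sub_sub_cancel]; exact h.nonempty_left

theorem IsMixed.ne_one_sub {l : F} (h : IsMixed Y l) (h2 : (2 : F) ≠ 0) : l ≠ 1 - l := by
  intro e
  apply h.ne_half
  field_simp
  linear_combination e

/-- An axis with a neighbour has a unique type. The third alternative covers a one-point component,
whose axis may have many types at once; there every nonempty typed part is the whole component. -/
theorem IsMixed.eq_or {l m : F} (h : IsMixed Y l) (h' : IsMixed Y m) :
    m = l ∨ m = 1 - l ∨
      ∀ ν : F, (componentOfType Y ν).Nonempty → componentOfType Y ν = Y.supp := by
  by_cases hs : Y.supp.Subsingleton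
  · refine Or.inr (Or.inr fun ν ⟨x, hx⟩ => Set.Subset.antisymm (fun y hy => hy.1) fun y hy => ?_)
    rwa [hs hy hx.1]
  · obtain ⟨x, hx⟩ := h.nonempty_left
    obtain ⟨y, hy, hxy⟩ : ∃ y ∈ Y.supp, x ≠ y := by
      by_contra! hcon
      exact hs fun u hu v hv => (hcon u hu).symm.trans (hcon v hv)
    obtain ⟨z, hz⟩ := exists_adj_of_ne hx.1 hy hxy
    have hn := (axialGraph_adj_iff hx.2).1 hz
    have hx' := hx.1
    rw [h'.union_eq] at hx'
    rcases hx' with h3 | h3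
    · exact Or.inl (hx.2.type_unique h3.2 hn).1
    · right; left
      linear_combination -(hx.2.type_unique h3.2 hn).1

/-! ### Selected sets, built component by component. -/

/-- The condition on `S` to be the intersection of a selected set with the component `Y`. -/
structure IsSelectedPart (Y : (axialGraph F A).ConnectedComponent)
    (S : Set (PrimitiveAxis F A)) : Prop where
  subset : S ⊆ Y.supp
  unmixed : (¬ ∃ lam : F, IsMixed Y lam) → S = Y.supp
  exceptional : ∀ lam : F, IsMixed Y lam → (lam = -1 ∨ lam = 2) → S = componentOfType Y 2
  mixed : ∀ lam : F, IsMixed Y lam → lam ≠ -1 → lam ≠ 2 →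
    S = componentOfType Y lam ∨ S = componentOfType Y (1 - lam)

theorem isSelectedSet_of_parts {S : (axialGraph F A).ConnectedComponent → Set (PrimitiveAxis F A)}
    (h : ∀ Y, IsSelectedPart Y (S Y)) :
    IsSelectedSet {x | x ∈ S ((axialGraph F A).connectedComponentMk x)} := by
  have e (Y : (axialGraph F A).ConnectedComponent) :
      Y.supp ∩ {x | x ∈ S ((axialGraph F A).connectedComponentMk x)} = S Y := by
    ext x
    constructor
    · rintro ⟨rfl, hx⟩
      exact hx
    · intro hx
      have hY := (h Y).subset hx
      refine ⟨hY, ?_⟩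
      rw [ConnectedComponent.mem_supp_iff] at hY
      subst hY
      exact hx
  exact ⟨fun Y hY => by rw [e, (h Y).unmixed hY],
    fun Y lam hY hl => by rw [e, (h Y).exceptional lam hY hl],
    fun Y lam hY hl hl' => by rw [e]; exact (h Y).mixed lam hY hl hl'⟩

theorem isSelectedPart_supp (h : ¬ ∃ lam : F, IsMixed Y lam) : IsSelectedPart Y Y.supp where
  subset := subset_rfl
  unmixed _ := rfl
  exceptional lam hl := absurd ⟨lam, hl⟩ h
  mixed lam hl := absurd ⟨lam, hl⟩ h

theorem IsMixed.neg_one_of_exceptional {l : F} (h : IsMixed Y l) (hl : l = -1 ∨ l = 2) :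
    IsMixed Y (-1 : F) := by
  rcases hl with rfl | rfl
  · exact h
  · have := h.symm
    rwa [show (1 : F) - 2 = -1 by norm_num] at this

theorem IsMixed.two_of_exceptional {l : F} (h : IsMixed Y l) (hl : l = -1 ∨ l = 2) :
    IsMixed Y (2 : F) := by
  have := (h.neg_one_of_exceptional hl).symm
  rwa [show (1 : F) - -1 = 2 by norm_num] at this

theorem isSelectedPart_exceptional {l : F} (h : IsMixed Y l) (hl : l = -1 ∨ l = 2) :
    IsSelectedPart Y (componentOfType Y 2) where
  subset _ hx := hx.1
  unmixed h' := absurd ⟨l, h⟩ h'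
  exceptional _ _ _ := rfl
  mixed m hm h1 h2 := by
    rcases (h.two_of_exceptional hl).eq_or hm with rfl | e | e
    · exact absurd rfl h2
    · exact absurd (e.trans (by norm_num)) h1
    · left
      rw [e 2 (h.two_of_exceptional hl).nonempty_left, e m hm.nonempty_left]

theorem isSelectedPart_mixed {l : F} (h : IsMixed Y l) (hl : l ≠ -1) (hl' : l ≠ 2) :
    IsSelectedPart Y (componentOfType Y l) where
  subset _ hx := hx.1
  unmixed h' := absurd ⟨l, h⟩ h'
  exceptional m hm hm' := by
    have hm2 := hm.two_of_exceptional hm'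
    rcases h.eq_or hm2 with e | e | e
    · exact absurd e.symm hl'
    · exact absurd (by linear_combination e) hl
    · rw [e 2 hm2.nonempty_left, e l h.nonempty_left]
  mixed m hm _ _ := by
    rcases h.eq_or hm with rfl | rfl | e
    · exact Or.inl rfl
    · right; rw [sub_sub_cancel]
    · left; rw [e m hm.nonempty_left, e l h.nonempty_left]

theorem exists_isSelectedPart (Y : (axialGraph F A).ConnectedComponent) :
    ∃ S, IsSelectedPart Y S := by
  by_cases h : ∃ lam : F, IsMixed Y lam
  · obtain ⟨l, h⟩ := h
    by_cases hl : l = -1 ∨ l = 2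
    · exact ⟨_, isSelectedPart_exceptional h hl⟩
    · exact ⟨_, isSelectedPart_mixed h (fun e => hl (Or.inl e)) (fun e => hl (Or.inr e))⟩
  · exact ⟨_, isSelectedPart_supp h⟩

theorem exists_isSelectedSet_of_part {S : Set (PrimitiveAxis F A)} (hS : IsSelectedPart Y S) :
    ∃ X' : Set (PrimitiveAxis F A), IsSelectedSet X' ∧ S ⊆ X' := by
  classical
  choose T hT using exists_isSelectedPart (F := F) (A := A)
  have h : ∀ Z, IsSelectedPart Z (Function.update T Y S Z) := by
    intro Z
    by_cases hZ : Z = Y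
    · subst hZ; rwa [Function.update_self]
    · rw [Function.update_of_ne hZ]; exact hT Z
  refine ⟨_, isSelectedSet_of_parts h, fun x hx => ?_⟩
  have hxY : (axialGraph F A).connectedComponentMk x = Y := hS.subset hx
  rw [Set.mem_ofPred_eq, hxY, Function.update_self]
  exact hx

theorem exists_isSelectedSet : ∃ X' : Set (PrimitiveAxis F A), IsSelectedSet X' := by
  choose T hT using exists_isSelectedPart (F := F) (A := A)
  exact ⟨_, isSelectedSet_of_parts hT⟩

/-- Every axis is in a selected set, unless it is in an exceptional mixed component and not of
type `2`. -/
theorem exists_isSelectedSet_mem (x : PrimitiveAxis F A) :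
    (∃ X' : Set (PrimitiveAxis F A), IsSelectedSet X' ∧ x ∈ X') ∨
    (IsMixed ((axialGraph F A).connectedComponentMk x) (-1 : F) ∧
      x ∉ componentOfType ((axialGraph F A).connectedComponentMk x) (2 : F)) := by
  set Y := (axialGraph F A).connectedComponentMk x with hY
  have hxY : x ∈ Y.supp := rfl
  by_cases h : ∃ lam : F, IsMixed Y lam
  · obtain ⟨l, h⟩ := h
    by_cases hl : l = -1 ∨ l = 2
    · have h1 := h.neg_one_of_exceptional hl
      by_cases hx : x ∈ componentOfType Y (2 : F)
      · obtain ⟨X', hX, hS⟩ := exists_isSelectedSet_of_part (isSelectedPart_exceptional h hl)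
        exact Or.inl ⟨X', hX, hS hx⟩
      · exact Or.inr ⟨h1, hx⟩
    · left
      push Not at hl
      have hx := hxY
      rw [h.union_eq] at hx
      rcases hx with hx | hx
      · obtain ⟨X', hX, hS⟩ := exists_isSelectedSet_of_part (isSelectedPart_mixed h hl.1 hl.2)
        exact ⟨X', hX, hS hx⟩
      · obtain ⟨X', hX, hS⟩ := exists_isSelectedSet_of_part (isSelectedPart_mixed h.symm
          (fun e => hl.2 (by linear_combination -e)) (fun e => hl.1 (by linear_combination -e)))
        exact ⟨X', hX, hS hx⟩
  · obtain ⟨X', hX, hS⟩ := exists_isSelectedSet_of_part (isSelectedPart_supp h)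
    exact Or.inl ⟨X', hX, hS hxY⟩

/-- Uniform description of the three cases: in a mixed component the discarded type `l` can always
be taken different from 2. -/
theorem IsSelectedSet.inter_supp (h2 : (2 : F) ≠ 0) {X' : Set (PrimitiveAxis F A)}
    (hX : IsSelectedSet X') (Y : (axialGraph F A).ConnectedComponent) :
    ((¬ ∃ lam : F, IsMixed Y lam) ∧ Y.supp ∩ X' = Y.supp) ∨
    ∃ l : F, IsMixed Y l ∧ l ≠ 2 ∧ Y.supp ∩ X' = componentOfType Y (1 - l) := by
  by_cases h : ∃ lam : F, IsMixed Y lam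
  · right
    obtain ⟨l, h⟩ := h
    by_cases hl : l = -1 ∨ l = 2
    · have h1 := h.neg_one_of_exceptional hl
      refine ⟨-1, h1, fun e => h1.ne_half ?_, ?_⟩
      · field_simp
        linear_combination e
      · rw [hX.exceptional Y l h hl]
        congr 1; norm_num
    · push Not at hl
      rcases hX.mixed Y l h hl.1 hl.2 with e | e
      · exact ⟨1 - l, h.symm, fun e => hl.1 (by linear_combination -e),
          by rw [e, sub_sub_cancel]⟩
      · exact ⟨l, h, hl.2, e⟩
  · exact Or.inl ⟨h, hX.unmixed Y h⟩

theorem IsSelectedSet.reflect_mem (h2 : (2 : F) ≠ 0) {X' : Set (PrimitiveAxis F A)}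
    (hX : IsSelectedSet X') {a : A} {l d : F} (ha : IsPrimitiveAxisOfType a l d)
    {x : PrimitiveAxis F A} (hx : x ∈ X') : ha.reflect x ∈ X' := by
  have hxY : x ∈ ((axialGraph F A).connectedComponentMk x).supp := rfl
  rcases hX.inter_supp h2 ((axialGraph F A).connectedComponentMk x) with ⟨-, e⟩ | ⟨m, -, -, e⟩
  · have : ha.reflect x ∈ ((axialGraph F A).connectedComponentMk x).supp :=
      connectedComponentMk_reflect ha x
    rw [← e] at this
    exact this.2
  · have h1 : x ∈ ((axialGraph F A).connectedComponentMk x).supp ∩ X' := ⟨hxY, hx⟩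
    rw [e] at h1
    have := reflect_mem_componentOfType ha h1
    rw [← e] at this
    exact this.2

/-- In a mixed component, an axis not of type `1 - l` is adjacent to one of type `1 - l`. -/
theorem IsMixed.exists_adj (h2 : (2 : F) ≠ 0) {l : F} (h : IsMixed Y l) (hl : l ≠ 2)
    {x : PrimitiveAxis F A} (hx : x ∈ Y.supp) :
    x ∈ componentOfType Y (1 - l) ∨
      ∃ y ∈ componentOfType Y (1 - l), (axialGraph F A).Adj x y := by
  obtain ⟨y, hy⟩ := h.nonempty_right
  have hr := (SimpleGraph.reachable_iff_reflTransGen y x).1 (reachable_of_mem_supp hy.1 hx)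
  clear hx
  induction hr with
  | refl => exact Or.inl hy
  | @tail c x hyc hcx ih =>
    rcases ih with hc | ⟨b, hb, hcb⟩
    · exact Or.inr ⟨c, hc, hcx.symm⟩
    · have hc : c ∈ Y.supp := mem_supp_of_adj hb.1 hcb.symm
      have hx : x ∈ Y.supp := mem_supp_of_adj hc hcx
      rw [h.union_eq] at hc
      rcases hc with hc | hc
      · rw [h.union_eq] at hx
        rcases hx with hx | hx
        · right
          -- Both `c` and `x` have type `l`: the neighbour `b` of `c`, or its reflection in `c`, is
          -- also a neighbour of `x`.
          rcases hx.2.odd_ne_zero_or_odd_miyamoto_ne_zero hc.2 hb.2 h2 (h.ne_one_sub h2) hl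
            ((axialGraph_adj_iff hx.2).1 hcx.symm) ((axialGraph_adj_iff hc.2).1 hcb) with h3 | h3
          · exact ⟨b, hb, (axialGraph_adj_iff hx.2).2 h3⟩
          · exact ⟨hc.2.reflect b, reflect_mem_componentOfType hc.2 hb,
              (axialGraph_adj_iff hx.2).2 h3⟩
        · exact Or.inl hx
      · exact Or.inr ⟨c, hc, hcx.symm⟩

end Graph

/-! ### Spanning by axes and by selected sets. -/

section Span

open IsPrimitiveAxisOfType

variable (F A) in
theorem span_primitiveAxis (h2 : (2 : F) ≠ 0) (hA : IsPAJ F A) :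
    Submodule.span F {a : A | IsPrimitiveAxis F a} = ⊤ := by
  obtain ⟨X, hX, hgen⟩ := hA
  set S := Submodule.span F {a : A | IsPrimitiveAxis F a} with hS
  have hmul : ∀ {x y : A}, x ∈ S → y ∈ S → x * y ∈ S := by
    intro x y hx hy
    induction hx using Submodule.span_induction with
    | zero => rw [zero_mul]; exact S.zero_mem
    | add u v _ _ hu hv => rw [add_mul]; exact S.add_mem hu hv
    | smul r u _ hu => rw [smul_mul_assoc]; exact S.smul_mem r hu
    | mem a ha =>
      induction hy using Submodule.span_induction with
      | zero => rw [mul_zero]; exact S.zero_mem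
      | add u v _ _ hu hv => rw [mul_add]; exact S.add_mem hu hv
      | smul r u _ hu => rw [mul_smul_comm]; exact S.smul_mem r hu
      | mem b hb =>
        obtain ⟨l, d, h⟩ := ha
        obtain ⟨l', d', h'⟩ := hb
        have h1 : b ∈ S := Submodule.subset_span ⟨l', d', h'⟩
        have h3 : h.miyamoto b ∈ S := Submodule.subset_span ⟨l', d', h.miyamoto_type h'⟩
        -- The odd part of `b` is half the difference of two axes, so the product of two axes is a
        -- combination of axes.
        have h4 := S.smul_mem (2 : F)⁻¹ (S.sub_mem h1 h3)
        rw [miyamoto_apply, sub_sub_cancel, inv_smul_smul₀ h2] at h4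
        rw [h.axis_mul]
        exact S.add_mem (S.smul_mem _ (Submodule.subset_span ⟨l, d, h⟩)) (S.smul_mem _ h4)
  have hle : NonUnitalAlgebra.adjoin F X ≤
      ({ S with mul_mem' := hmul } : NonUnitalSubalgebra F A) :=
    NonUnitalAlgebra.adjoin_le fun a ha => Submodule.subset_span (hX a ha)
  rw [hgen] at hle
  exact eq_top_iff.2 fun x _ => hle (NonUnitalAlgebra.mem_top (R := F) (x := x))

theorem IsSelectedSet.span_eq_top (h2 : (2 : F) ≠ 0) (hA : IsPAJ F A)
    {X' : Set (PrimitiveAxis F A)} (hX : IsSelectedSet X') :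
    Submodule.span F ((fun x : PrimitiveAxis F A => (x : A)) '' X') = ⊤ := by
  rw [eq_top_iff, ← span_primitiveAxis F A h2 hA, Submodule.span_le]
  intro a ha
  let x : PrimitiveAxis F A := ⟨a, ha⟩
  set Y := (axialGraph F A).connectedComponentMk x with hY
  have hxY : x ∈ Y.supp := rfl
  have sub {z : PrimitiveAxis F A} (hz : z ∈ Y.supp ∩ X') :
      (z : A) ∈ Submodule.span F ((fun x : PrimitiveAxis F A => (x : A)) '' X') :=
    Submodule.subset_span ⟨z, hz.2, rfl⟩
  rcases hX.inter_supp h2 Y with ⟨-, e⟩ | ⟨l, h, hl, e⟩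
  · exact sub (z := x) (by rw [e]; exact hxY)
  · rw [e] at sub
    rcases h.exists_adj h2 hl hxY with hx | ⟨y, hy, hxy⟩
    · exact sub hx
    · have hx := hxY
      rw [h.union_eq] at hx
      rcases hx with hx | hx
      · have h1 := reflect_mem_componentOfType hx.2 hy
        exact hx.2.mem_of_miyamoto_mem hy.2 h2 (h.ne_one_sub h2) hl
          ((axialGraph_adj_iff hx.2).1 hxy) (sub hy) (sub h1)
          (sub (reflect_mem_componentOfType hy.2 h1))
      · exact sub hx

end Span

/-! ### Symmetry of the projections and construction of the form. -/

section Form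

open SimpleGraph IsPrimitiveAxisOfType

theorem IsSelectedSet.axisProj_comm (h2 : (2 : F) ≠ 0) {X' : Set (PrimitiveAxis F A)}
    (hX : IsSelectedSet X') {x y : PrimitiveAxis F A} (hxX : x ∈ X') (hyX : y ∈ X') :
    axisProj F (x : A) y = axisProj F (y : A) x := by
  obtain ⟨l, d, hx⟩ := x.2
  obtain ⟨l', d', hy⟩ := y.2
  rw [← hx.coeff_apply, ← hy.coeff_apply]
  by_cases hn : hx.odd y = 0
  · rcases hx.eq_or_mul_eq_zero hy hn with h | ⟨h, h'⟩
    · obtain rfl : x = y := Subtype.ext h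
      rfl
    · rw [(hx.coeff_odd_eq_zero_of_mul h).1, (hy.coeff_odd_eq_zero_of_mul h').1]
  · have hm := hx.odd_ne_zero_symm hy hn
    by_cases hld : l = d
    · subst hld
      obtain rfl : l' = d' := by
        by_contra hne
        exact (hy.noncommutative_pair hx hne hm).2.1 rfl
      rcases commutative_pair hx hy h2 hn hm with ⟨-, h⟩ | ⟨h, hl, -⟩
      · exact h
      · exfalso
        obtain rfl : l' = 1 - l := by linear_combination h
        have hadj := (axialGraph_adj_iff hx).2 hn
        set Y := (axialGraph F A).connectedComponentMk x
        have hxY : x ∈ componentOfType Y l := ⟨rfl, hx⟩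
        have hyY : y ∈ componentOfType Y (1 - l) := ⟨mem_supp_of_adj hxY.1 hadj, hy⟩
        have hY : IsMixed Y l :=
          { ne_half := fun e => hl (by rw [e]; field_simp)
            union_eq := Set.Subset.antisymm (fun z hz => mem_componentOfType_or h2 hxY hz)
              (Set.union_subset (fun z hz => hz.1) (fun z hz => hz.1))
            nonempty_left := ⟨x, hxY⟩
            nonempty_right := ⟨y, hyY⟩ }
        rcases hX.inter_supp h2 Y with ⟨h', -⟩ | ⟨m, -, -, e⟩
        · exact h' ⟨l, hY⟩
        · have hx' : x ∈ Y.supp ∩ X' := ⟨hxY.1, hxX⟩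
          have hy' : y ∈ Y.supp ∩ X' := ⟨hyY.1, hyX⟩
          rw [e] at hx' hy'
          have e1 := (hx.type_unique hx'.2 hn).1
          have e2 := (hy.type_unique hy'.2 hm).1
          exact hl (by linear_combination e2 - e1)
    · rcases (hx.noncommutative_pair hy hld hn).2.2.2 with ⟨-, -, h, h', -⟩ | ⟨-, -, h, h', -⟩ <;>
        rw [h, h']

/-- Associativity with a = a² makes `a` orthogonal, on both sides, to eigenvectors with eigenvalue
other than 1. -/
theorem IsFrobeniusForm.apply_axis {B : LinearMap.BilinForm F A} (hB : IsFrobeniusForm B)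
    {a : A} {l d : F} (ha : IsPrimitiveAxisOfType a l d) (u : A) :
    B a u = ha.coeff u * B a a ∧ B u a = ha.coeff u * B a a := by
  obtain ⟨z, hu, h1, h2, h3, h4⟩ := ha.decomposition u
  have z1 : B a z = 0 := by rw [← ha.idem, ← hB.assoc, h1, map_zero]
  have z2 : B z a = 0 := by rw [← ha.idem, hB.assoc, h2, map_zero, LinearMap.zero_apply]
  have o1 : B a (ha.odd u) = 0 := by
    have h := hB.assoc a a (ha.odd u)
    rw [h3, ha.idem, map_smul, smul_eq_mul] at h
    have : (1 - l) * B a (ha.odd u) = 0 := by linear_combination -h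
    exact (mul_eq_zero.1 this).resolve_left (sub_ne_zero.2 ha.lam_ne_one.symm)
  have o2 : B (ha.odd u) a = 0 := by
    have h := hB.assoc (ha.odd u) a a
    rw [h4, ha.idem, map_smul, LinearMap.smul_apply, smul_eq_mul] at h
    have : (1 - d) * B (ha.odd u) a = 0 := by linear_combination h
    exact (mul_eq_zero.1 this).resolve_left (sub_ne_zero.2 ha.del_ne_one.symm)
  constructor
  · conv_lhs => rw [hu]
    rw [map_add, map_add, map_smul, z1, o1, smul_eq_mul, add_zero, add_zero]
  · conv_lhs => rw [hu]
    rw [map_add, map_add, map_smul, LinearMap.add_apply, LinearMap.add_apply,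
      LinearMap.smul_apply, z2, o2, smul_eq_mul, add_zero, add_zero]

theorem IsNormalizedFrobeniusForm.apply_axis {X' : Set (PrimitiveAxis F A)}
    {B : LinearMap.BilinForm F A} (hB : IsNormalizedFrobeniusForm X' B) {x : PrimitiveAxis F A}
    (hx : x ∈ X') (u : A) : B (x : A) u = axisProj F (x : A) u := by
  obtain ⟨l, d, h⟩ := x.2
  rw [(hB.toIsFrobeniusForm.apply_axis h u).1, hB.norm_one x hx, mul_one, h.coeff_apply]

/-- The bilinear form with `(a, u) = φ_a(u)` for all axes `a` of a selected set. -/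
theorem IsSelectedSet.exists_form (h2 : (2 : F) ≠ 0) (hA : IsPAJ F A)
    {X' : Set (PrimitiveAxis F A)} (hX : IsSelectedSet X') :
    ∃ B : LinearMap.BilinForm F A, ∀ x ∈ X', ∀ u, B (x : A) u = axisProj F (x : A) u := by
  choose l d h using fun x : X' => x.1.2
  have hspan := hX.span_eq_top h2 hA
  let Φ : (X' →₀ F) →ₗ[F] A := Finsupp.linearCombination F fun x : X' => ((x : PrimitiveAxis F A) : A)
  let Ψ : (X' →₀ F) →ₗ[F] (A →ₗ[F] F) := Finsupp.linearCombination F fun x : X' => (h x).coeff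
  have hΦ : LinearMap.range Φ = ⊤ := by
    rw [Finsupp.range_linearCombination, ← hspan, Set.image_eq_range]
  -- By symmetry of φ on `X'`, the functional `Ψ c` depends only on the vector `Φ c`, because the
  -- axes `y` span.
  have hsymm : ∀ (y : X') (c : X' →₀ F), Ψ c (y : A) = (h y).coeff (Φ c) := by
    intro y c
    induction c using Finsupp.induction_linear with
    | zero => simp
    | add f g hf hg => rw [map_add, map_add, map_add, LinearMap.add_apply, hf, hg]
    | single x r =>
      simp only [Φ, Ψ, Finsupp.linearCombination_single, LinearMap.smul_apply, map_smul,
        coeff_apply, hX.axisProj_comm h2 x.2 y.2]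
  have hker : ∀ c, Φ c = 0 → Ψ c = 0 := by
    intro c hc
    apply LinearMap.ext_on hspan
    rintro _ ⟨y, hy, rfl⟩
    have := hsymm ⟨y, hy⟩ c
    rw [hc, map_zero] at this
    simpa using this
  obtain ⟨g, hg⟩ := Φ.exists_rightInverse_of_surjective hΦ
  refine ⟨Ψ ∘ₗ g, fun x hx u => ?_⟩
  have h0 : Φ (g (x : A) - Finsupp.single ⟨x, hx⟩ 1) = 0 := by
    have hgx : Φ (g (x : A)) = x := LinearMap.congr_fun hg (x : A)
    rw [map_sub, hgx]
    simp [Φ]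
  have h1 := hker _ h0
  rw [map_sub, sub_eq_zero] at h1
  rw [LinearMap.comp_apply, h1]
  simp [Ψ, coeff_apply]

/-! ### Associativity and uniqueness of the form. -/

section Associativity

variable {X' : Set (PrimitiveAxis F A)} {B : LinearMap.BilinForm F A}

theorem IsSelectedSet.form_symm (h2 : (2 : F) ≠ 0) (hA : IsPAJ F A) (hX : IsSelectedSet X')
    (hB : ∀ x ∈ X', ∀ u, B (x : A) u = axisProj F (x : A) u) (u v : A) : B u v = B v u := by
  have hspan := hX.span_eq_top h2 hA
  have : B = B.flip := by
    apply LinearMap.ext_on hspan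
    rintro _ ⟨x, hx, rfl⟩
    apply LinearMap.ext_on hspan
    rintro _ ⟨y, hy, rfl⟩
    show B (x : A) (y : A) = B (y : A) (x : A)
    rw [hB x hx, hB y hy, hX.axisProj_comm h2 hx hy]
  exact LinearMap.congr_fun (LinearMap.congr_fun this u) v

/-- The Miyamoto involution maps `X'` into itself and respects the projections, so it preserves `B`;
its 1- and (-1)-eigenvectors are therefore orthogonal. -/
theorem IsSelectedSet.form_even_odd (h2 : (2 : F) ≠ 0) (hA : IsPAJ F A) (hX : IsSelectedSet X')
    (hB : ∀ x ∈ X', ∀ u, B (x : A) u = axisProj F (x : A) u) {a : A} {l d : F}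
    (ha : IsPrimitiveAxisOfType a l d) (u v : A) : B u (ha.odd v) = B (ha.odd u) (ha.odd v) := by
  have hspan := hX.span_eq_top h2 hA
  have inv : B.compl₁₂ ha.miyamoto ha.miyamoto = B := by
    apply LinearMap.ext_on hspan
    rintro _ ⟨x, hx, rfl⟩
    obtain ⟨m, e, hx'⟩ := x.2
    ext v
    rw [LinearMap.compl₁₂_apply, hB x hx, ← coe_reflect, hB _ (hX.reflect_mem h2 ha hx)]
    exact hx'.axisProj_map ha.miyamotoEquiv ha.miyamoto_mul v
  have h : B (ha.miyamoto u) (ha.miyamoto (ha.odd v)) = B u (ha.odd v) :=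
    LinearMap.congr_fun (LinearMap.congr_fun inv u) (ha.odd v)
  simp only [miyamoto_apply, ha.odd_odd, map_sub, map_smul, LinearMap.sub_apply,
    LinearMap.smul_apply, smul_eq_mul] at h
  apply mul_left_cancel₀ h2
  linear_combination -h

/-- Here the odd part of `b` is b - a, so the value is φ_b(c) - φ_a(c). When `c` is adjacent to
both, each term is 1 or 0 according as `c` has type (l,d) or (d,l). -/
theorem IsSelectedSet.form_odd_odd_of_same_type (h2 : (2 : F) ≠ 0) (hA : IsPAJ F A)
    (hX : IsSelectedSet X')
    (hB : ∀ x ∈ X', ∀ u, B (x : A) u = axisProj F (x : A) u) {a b c : PrimitiveAxis F A} {l d : F}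
    (haX : a ∈ X') (hbX : b ∈ X') (ha : IsPrimitiveAxisOfType (a : A) l d)
    (hb : IsPrimitiveAxisOfType (b : A) l d) (hld : l ≠ d) (hn : ha.odd b ≠ 0) :
    B (ha.odd b) (ha.odd c) = 0 := by
  by_cases hc0 : ha.odd c = 0
  · rw [hc0, map_zero]
  obtain ⟨hs, -, hm, ⟨-, -, hab, hba, hodd⟩ | ⟨h, -⟩⟩ := ha.noncommutative_pair hb hld hn
  swap
  · exact absurd h hld
  have hsymm := hX.form_symm h2 hA hB
  have e1 : B (ha.odd b) (ha.odd c) = hb.coeff c - ha.coeff c := by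
    rw [hsymm, ← hX.form_even_odd h2 hA hB, hodd, map_sub, hsymm _ (b : A), hsymm _ (a : A),
      hB b hbX, hB a haX, hb.coeff_apply, ha.coeff_apply]
  rw [e1]
  obtain ⟨l', d', hc⟩ := c.2
  by_cases hbc : hb.odd c = 0
  · rcases hb.eq_or_mul_eq_zero hc hbc with h | ⟨h, h'⟩
    · rw [← h, hb.coeff_self, hab, sub_self]
    · rw [(hb.coeff_odd_eq_zero_of_mul h).1, zero_sub, neg_eq_zero]
      obtain ⟨-, -, -, ⟨-, -, -, -, hodd'⟩ | ⟨-, -, h0, -⟩⟩ := ha.noncommutative_pair hc hld hc0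
      swap
      · exact h0
      exfalso
      -- Products of odd elements are even; with bc = cb = 0, the two orders give two relations
      -- whose determinant (d - l)(l + d) = d - l is nonzero.
      have k1 : d • ha.odd b + l • ha.odd c = 0 := by
        have := ha.odd_odd_mul_odd b c
        have e : ha.odd b * ha.odd c = a - b * a - a * c := by
          rw [hodd, hodd', sub_mul, mul_sub, mul_sub, ha.idem, h]; abel
        rw [e, ha.mul_axis, ha.axis_mul] at this
        simp only [map_add, map_sub, map_smul, ha.odd_self, ha.odd_odd, smul_zero] at this
        linear_combination (norm := module) (-1 : F) • this
      have k2 : d • ha.odd c + l • ha.odd b = 0 := by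
        have := ha.odd_odd_mul_odd c b
        have e : ha.odd c * ha.odd b = a - c * a - a * b := by
          rw [hodd, hodd', sub_mul, mul_sub, mul_sub, ha.idem, h']; abel
        rw [e, ha.mul_axis, ha.axis_mul] at this
        simp only [map_add, map_sub, map_smul, ha.odd_self, ha.odd_odd, smul_zero] at this
        linear_combination (norm := module) (-1 : F) • this
      have k3 : ((d - l) * (l + d)) • ha.odd b = 0 := by
        linear_combination (norm := module) d • k1 - l • k2
      rw [hs, mul_one] at k3
      exact (smul_eq_zero.1 k3).elim (fun h => hld (sub_eq_zero.1 h).symm) hn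
  · obtain ⟨-, -, -, ⟨hl, -, h1, -⟩ | ⟨hl, -, h1, -⟩⟩ := hb.noncommutative_pair hc hld hbc <;>
    obtain ⟨-, -, -, ⟨hl', -, h1', -⟩ | ⟨hl', -, h1', -⟩⟩ := ha.noncommutative_pair hc hld hc0
    · rw [h1, h1', sub_self]
    · exact absurd (hl.symm.trans hl') hld
    · exact absurd (hl'.symm.trans hl) hld
    · rw [h1, h1', sub_self]

theorem IsSelectedSet.form_odd_odd (h2 : (2 : F) ≠ 0) (hA : IsPAJ F A) (hX : IsSelectedSet X')
    (hB : ∀ x ∈ X', ∀ u, B (x : A) u = axisProj F (x : A) u) {a : PrimitiveAxis F A} {l d : F}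
    (haX : a ∈ X') (ha : IsPrimitiveAxisOfType (a : A) l d) (hld : l ≠ d) (u v : A) :
    B (ha.odd u) (ha.odd v) = 0 := by
  have hspan := hX.span_eq_top h2 hA
  have hsymm := hX.form_symm h2 hA hB
  have key : B.compl₁₂ ha.odd ha.odd = 0 := by
    apply LinearMap.ext_on hspan
    rintro _ ⟨b, hbX, rfl⟩
    apply LinearMap.ext_on hspan
    rintro _ ⟨c, hcX, rfl⟩
    show B (ha.odd b) (ha.odd c) = 0
    by_cases hb0 : ha.odd b = 0
    · rw [hb0, map_zero, LinearMap.zero_apply]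
    by_cases hc0 : ha.odd c = 0
    · rw [hc0, map_zero]
    obtain ⟨lb, db, hb⟩ := b.2
    obtain ⟨lc, dc, hc⟩ := c.2
    obtain ⟨-, -, -, ⟨rfl, rfl, -⟩ | ⟨rfl, rfl, -, -, hbo⟩⟩ := ha.noncommutative_pair hb hld hb0
    · exact hX.form_odd_odd_of_same_type h2 hA hB haX hbX ha hb hld hb0
    obtain ⟨-, -, -, ⟨rfl, rfl, -⟩ | ⟨rfl, rfl, -⟩⟩ := ha.noncommutative_pair hc hld hc0
    · rw [hsymm]
      exact hX.form_odd_odd_of_same_type h2 hA hB haX hcX ha hc hld hc0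
    -- Both `b` and `c` have the type opposite to `a`. Since `a` and `b` share their odd parts, the
    -- value can be computed for the axis `b`, which has the type of `c`.
    rw [hsymm, ← hX.form_even_odd h2 hA hB, ← hbo, hX.form_even_odd h2 hA hB]
    by_cases hbc : hb.odd c = 0
    · rw [hbc, map_zero, LinearMap.zero_apply]
    · exact hX.form_odd_odd_of_same_type h2 hA hB hbX hcX hb hc hld.symm hbc
  exact LinearMap.congr_fun (LinearMap.congr_fun key u) v

theorem IsSelectedSet.form_assoc (h2 : (2 : F) ≠ 0) (hA : IsPAJ F A) (hX : IsSelectedSet X')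
    (hB : ∀ x ∈ X', ∀ u, B (x : A) u = axisProj F (x : A) u) (x y z : A) :
    B x (y * z) = B (x * y) z := by
  have hspan := hX.span_eq_top h2 hA
  have hsymm := hX.form_symm h2 hA hB
  have hy : y ∈ Submodule.span F ((fun x : PrimitiveAxis F A => (x : A)) '' X') := by
    rw [hspan]; trivial
  induction hy using Submodule.span_induction with
  | zero => simp
  | add u v _ _ hu hv => rw [add_mul, mul_add, map_add, map_add, LinearMap.add_apply, hu, hv]
  | smul r u _ hu => rw [smul_mul_assoc, mul_smul_comm, map_smul, map_smul, LinearMap.smul_apply, hu]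
  | mem _ h =>
    obtain ⟨a, haX, rfl⟩ := h
    obtain ⟨l, d, ha⟩ := a.2
    have e := hX.form_even_odd h2 hA hB ha
    -- The only obstruction to associativity with an axis in the middle.
    have hl : l * B (ha.odd x) (ha.odd z) = d * B (ha.odd x) (ha.odd z) := by
      by_cases hld : l = d
      · subst hld; rfl
      · rw [hX.form_odd_odd h2 hA hB haX ha hld, mul_zero, mul_zero]
    show B x (a * z) = B (x * a) z
    rw [ha.axis_mul, ha.mul_axis]
    simp only [map_add, map_smul, LinearMap.add_apply, LinearMap.smul_apply, smul_eq_mul]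
    rw [hsymm x a, hB a haX, hB a haX, ← ha.coeff_apply, ← ha.coeff_apply, e x z,
      hsymm (ha.odd x) z, e z x, hsymm (ha.odd z), hl, mul_comm]

theorem IsSelectedSet.existsUnique_form [Nontrivial A] (h2 : (2 : F) ≠ 0) (hA : IsPAJ F A)
    (hX : IsSelectedSet X') : ∃! B : LinearMap.BilinForm F A, IsNormalizedFrobeniusForm X' B := by
  have hspan := hX.span_eq_top h2 hA
  obtain ⟨B, hB⟩ := hX.exists_form h2 hA
  have h1 : ∀ a ∈ X', B (a : A) (a : A) = 1 := by
    intro a ha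
    obtain ⟨l, d, h⟩ := a.2
    rw [hB a ha, ← h.coeff_apply, h.coeff_self]
  refine ⟨B, ⟨⟨?_, hX.form_assoc h2 hA hB⟩, h1⟩, ?_⟩
  · rintro rfl
    have hne : X'.Nonempty := by
      rw [Set.nonempty_iff_ne_empty]
      rintro rfl
      rw [Set.image_empty, Submodule.span_empty] at hspan
      exact bot_ne_top hspan
    obtain ⟨a, ha⟩ := hne
    exact zero_ne_one (h1 a ha)
  · intro B' hB'
    apply LinearMap.ext_on hspan
    rintro _ ⟨a, ha, rfl⟩
    ext u
    rw [hB'.apply_axis ha, hB a ha]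

end Associativity

end Form

end JordanType

/-! ### The theorem, with the radical argument for type -1. -/

theorem mainTheorem7 {F : Type*} [Field F] (hF : ringChar F ≠ 2)
    {A : Type*} [NonUnitalNonAssocRing A] [Module F A] [IsScalarTower F A A] [SMulCommClass F A A]
    [Nontrivial A] (hA : IsPAJ F A) :
    (∃ X' : Set (PrimitiveAxis F A), IsSelectedSet X') ∧
    (∀ X' : Set (PrimitiveAxis F A), IsSelectedSet X' →
      Submodule.span F ((fun x : PrimitiveAxis F A => (x : A)) '' X') = ⊤ ∧
      (∃! B : LinearMap.BilinForm F A, IsNormalizedFrobeniusForm X' B) ∧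
      (∀ B : LinearMap.BilinForm F A, IsNormalizedFrobeniusForm X' B →
        ∀ a ∈ X', ∀ u : A, B (a : A) u = axisProj F (a : A) u)) ∧
    (∀ a : PrimitiveAxis F A,
      (∃ X' : Set (PrimitiveAxis F A), IsSelectedSet X' ∧ a ∈ X') ∨
      ((-1 : F) ≠ 1 / 2 ∧ IsPrimitiveAxisOfType (a : A) (-1 : F) (-1 : F) ∧
        (∃ b : PrimitiveAxis F A, IsPrimitiveAxisOfType (b : A) (2 : F) (2 : F) ∧
          (a : A) * (b : A) ≠ 0) ∧
        ∀ B : LinearMap.BilinForm F A, IsFrobeniusForm B → (a : A) ∈ LinearMap.ker B)) := by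
  have h2 : (2 : F) ≠ 0 := Ring.two_ne_zero hF
  refine ⟨exists_isSelectedSet, fun X' hX => ⟨hX.span_eq_top h2 hA, hX.existsUnique_form h2 hA,
    fun B hB a ha u => hB.apply_axis ha u⟩, fun a => ?_⟩
  refine (exists_isSelectedSet_mem a).imp_right fun ⟨hY, ha2⟩ => ?_
  have h3 : (3 : F) ≠ 0 := fun h => hY.ne_half (by field_simp; linear_combination -h)
  have haY : a ∈ ((axialGraph F A).connectedComponentMk a).supp := rfl
  have ha := haY
  have e2 : (1 : F) - -1 = 2 := by norm_num
  rw [hY.union_eq, e2] at ha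
  replace ha := (ha.resolve_right ha2).2
  have hadj := hY.exists_adj h2 (fun h => h3 (by linear_combination -h)) haY
  rw [e2] at hadj
  obtain ⟨b, hb, hab⟩ := hadj.resolve_left ha2
  have hn := (axialGraph_adj_iff ha).1 hab
  refine ⟨hY.ne_half, ha, ⟨b, hb.2, fun h => hn (ha.coeff_odd_eq_zero_of_mul h).2⟩,
    fun B hB => ?_⟩
  -- With types -1 and 2 these read 2φ_a(b) = 3 and 2φ_b(a) = 0.
  obtain ⟨-, hφ, hψ⟩ := ha.coeff_of_type_ne hb.2 h2 (fun h => h3 (by linear_combination -h)) hn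
  have e1 := (hB.apply_axis ha b).1
  rw [(hB.apply_axis hb.2 a).2] at e1
  have e3 : 3 * B (a : A) (a : A) = 0 := by
    linear_combination -2 * e1 - B (a : A) (a : A) * hφ + B (b : A) (b : A) * hψ
  have e4 := (mul_eq_zero.1 e3).resolve_left h3
  rw [LinearMap.mem_ker]
  ext u
  rw [(hB.apply_axis ha u).1, e4, mul_zero, LinearMap.zero_apply]
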